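/- Let $d\ge 4$ be an even integer. A state on $\mathbb C^d\otimes\mathbb C^d$ is a positive semidefinite matrix of trace one. For $k\ge 1$ let $\mathcal{SN}_k$ be the convex hull of the projections $|\xi\rangle\langle\xi|$ onto unit vectors $\xi\in\mathbb C^d\otimes\mathbb C^d$ of Schmidt rank at most $k$ (the Schmidt rank is the number of terms in a Schmidt decomposition), and let the Schmidt number $\mathrm{SN}(\rho)$ of a state $\rho$ be the least $k$ with $\rho\in\mathcal{SN}_k$. Let $\rho^\Gamma=(\mathrm{id}\otimes\top)(\rho)$ be the partial transpose, $\rho_A=(\mathrm{id}\otimes\mathrm{Tr})(\rho)$, $|\omega_d\rangle=\frac1{\sqrt d}\sum_{j=1}^d|jj\rangle$, $F_d=\sum_{i,j=1}^d|ij\rangle\langle ji|$, and $F_d^V=(I_d\otimes V)F_d(I_d\otimes V)^*$ for a $d\times d$ matrix $V$. A skew-symmetric unitary is a unitary $d\times d$ matrix $V$ with $V^\top=-V$; an example is $\Omega_d=\begin{pmatrix}0&I_{d/2}\\-I_{d/2}&0\end{pmatrix}$. For $a,b\in\mathbb R$ put $$\rho_{a,b}=\frac{1-a-b}{d^2}\,I_d\otimes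 I_d+a\,|\omega_d\rangle\langle\omega_d|+\frac bd\,F_d^{\Omega_d},\qquad \mathbb S_k=\{(a,b)\in\mathbb R^2:\ \rho_{a,b}\in\mathcal{SN}_k\}.$$ Let $\rho$ be a state on $\mathbb C^d\otimes\mathbb C^d$. (1) If $1\le k\le d/2$ and $\mathrm{SN}(\rho)\le k$, then for every skew-symmetric unitary $V$, $$\rho+k(I_d\otimes V)\rho^\Gamma(I_d\otimes V)^*\le k(\rho_A\otimes I_d)$$ in the Loewner order. (2) For every skew-symmetric unitary $V$, the numbers $$a(V)=\frac{-1+\mathrm{Tr}(F_d^V\rho)+(d^2-d)\langle\omega_d|\rho|\omega_d\rangle}{d^2-d-2},\qquad b(V)=\frac{-1+(d-1)\mathrm{Tr}(F_d^V\rho)+d\,\langle\omega_d|\rho|\omega_d\rangle}{d^2-d-2}$$ are real, and if $1\le k\le d$ and $\mathrm{SN}(\rho)\le k$, then $(a(V),b(V))\in\mathbb S_k$. -/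

import Mathlib

open scoped Kronecker ComplexOrder MatrixOrder

noncomputable section

/-- Matrices acting on `ℂ^d ⊗ ℂ^d`, indexed by pairs (first index: system A, second: system B). -/
abbrev BipartiteMatrix (d : ℕ) : Type := Matrix (Fin d × Fin d) (Fin d × Fin d) ℂ

/-- Vectors of the Hilbert space `ℂ^d ⊗ ℂ^d`. -/
abbrev BipartiteVector (d : ℕ) : Type := EuclideanSpace ℂ (Fin d × Fin d)

/-- A quantum state: a positive semidefinite matrix of unit trace. -/
def IsQuantumState {d : ℕ} (ρ : BipartiteMatrix d) : Prop :=
  ρ.PosSemidef ∧ ρ.trace = 1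

/-- `ξ` has Schmidt rank `r`: it admits a Schmidt decomposition
`ξ = ∑ i, c i • (v i ⊗ w i)` with exactly `r` strictly positive coefficients `c i` and
orthonormal families `v`, `w`. -/
def HasSchmidtRank {d : ℕ} (ξ : BipartiteVector d) (r : ℕ) : Prop :=
  ∃ (c : Fin r → ℝ) (v w : Fin r → EuclideanSpace ℂ (Fin d)),
    (∀ i, 0 < c i) ∧ Orthonormal ℂ v ∧ Orthonormal ℂ w ∧
      ∀ x y : Fin d, ξ (x, y) = ∑ i, (c i : ℂ) * (v i x * w i y)

/-- The rank-one operator `|ξ⟩⟨ξ|`. -/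
def pureState {d : ℕ} (ξ : BipartiteVector d) : BipartiteMatrix d :=
  Matrix.of fun p q => ξ p * star (ξ q)

/-- `SN_k`: the convex hull of the pure states `|ξ⟩⟨ξ|`, `ξ` a unit vector of Schmidt rank at
most `k`. -/
def schmidtSet (d k : ℕ) : Set (BipartiteMatrix d) :=
  convexHull ℝ {σ | ∃ ξ : BipartiteVector d,
    ‖ξ‖ = 1 ∧ (∃ r ≤ k, HasSchmidtRank ξ r) ∧ σ = pureState ξ}

/-- The Schmidt number: the least `k` with `ρ ∈ SN_k` (and `⊤` if there is none, which does not
happen for quantum states). -/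
def schmidtNumber {d : ℕ} (ρ : BipartiteMatrix d) : ℕ∞ :=
  ⨅ (k : ℕ) (_ : ρ ∈ schmidtSet d k), (k : ℕ∞)

/-- The partial transpose `ρ^Γ = (id ⊗ ⊤)(ρ)`. -/
def partialTranspose {d : ℕ} (ρ : BipartiteMatrix d) : BipartiteMatrix d :=
  Matrix.of fun p q => ρ (p.1, q.2) (q.1, p.2)

/-- The reduced matrix `ρ_A = (id ⊗ Tr)(ρ)`. -/
def reducedA {d : ℕ} (ρ : BipartiteMatrix d) : Matrix (Fin d) (Fin d) ℂ :=
  Matrix.of fun i j => ∑ l, ρ (i, l) (j, l)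

/-- `Ad_{I ⊗ V}(X) = (I ⊗ V) X (I ⊗ V)^*`. -/
def adRight {d : ℕ} (V : Matrix (Fin d) (Fin d) ℂ) (X : BipartiteMatrix d) : BipartiteMatrix d :=
  ((1 : Matrix (Fin d) (Fin d) ℂ) ⊗ₖ V) * X * ((1 : Matrix (Fin d) (Fin d) ℂ) ⊗ₖ V).conjTranspose

/-- The maximally entangled unit vector `ω_d = d^{-1/2} ∑ j, |jj⟩`. -/
def maxEntangled (d : ℕ) : BipartiteVector d :=
  WithLp.toLp 2 fun p => if p.1 = p.2 then ((1 / Real.sqrt d : ℝ) : ℂ) else 0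

/-- The flip operator `F_d = ∑ i j, |ij⟩⟨ji|`. -/
def flipMatrix (d : ℕ) : BipartiteMatrix d :=
  Matrix.of fun p q => if p.1 = q.2 ∧ p.2 = q.1 then 1 else 0

/-- The standard symplectic matrix `Ω_d`, with blocks `0, I, -I, 0` of size `d / 2`
(`d` even). -/
def symplecticOmega (d : ℕ) : Matrix (Fin d) (Fin d) ℂ :=
  Matrix.of fun i j =>
    if (j : ℕ) = i + d / 2 then 1 else if (i : ℕ) = j + d / 2 then -1 else 0

/-- A skew-symmetric unitary matrix. -/
def IsSkewUnitary {d : ℕ} (V : Matrix (Fin d) (Fin d) ℂ) : Prop :=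
  V ∈ Matrix.unitaryGroup (Fin d) ℂ ∧ V.transpose = -V

/-- `ρ_{a,b} = (1-a-b)/d² I ⊗ I + a |ω_d⟩⟨ω_d| + (b/d) (I ⊗ Ω_d) F_d (I ⊗ Ω_d)^*`. -/
def symplecticMatrix (d : ℕ) (a b : ℝ) : BipartiteMatrix d :=
  (((1 - a - b) / (d : ℝ) ^ 2 : ℝ) : ℂ) • (1 : BipartiteMatrix d)
    + (a : ℂ) • pureState (maxEntangled d)
    + ((b / (d : ℝ) : ℝ) : ℂ) • adRight (symplecticOmega d) (flipMatrix d)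

/-- The region `S_k = {(a,b) ∈ ℝ² : ρ_{a,b} ∈ SN_k}`. -/
def symplecticRegion (d k : ℕ) : Set (ℝ × ℝ) :=
  {p | symplecticMatrix d p.1 p.2 ∈ schmidtSet d k}

/-- `Tr(F_d^V ρ)` with `F_d^V = Ad_{I ⊗ V}(F_d)`. -/
def flipValue {d : ℕ} (V : Matrix (Fin d) (Fin d) ℂ) (ρ : BipartiteMatrix d) : ℂ :=
  (adRight V (flipMatrix d) * ρ).trace

/-- `⟨ω_d|ρ|ω_d⟩`. -/
def omegaValue {d : ℕ} (ρ : BipartiteMatrix d) : ℂ :=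
  ∑ p, ∑ q, star (maxEntangled d p) * ρ p q * maxEntangled d q

/-- The parameter `a(V)`, as a complex number. -/
def paramA {d : ℕ} (V : Matrix (Fin d) (Fin d) ℂ) (ρ : BipartiteMatrix d) : ℂ :=
  1 / ((d : ℂ) ^ 2 - d - 2) * (-1 + flipValue V ρ + ((d : ℂ) ^ 2 - d) * omegaValue ρ)

/-- The parameter `b(V)`, as a complex number. -/
def paramB {d : ℕ} (V : Matrix (Fin d) (Fin d) ℂ) (ρ : BipartiteMatrix d) : ℂ :=
  1 / ((d : ℂ) ^ 2 - d - 2) * (-1 + ((d : ℂ) - 1) * flipValue V ρ + (d : ℂ) * omegaValue ρ)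

end

open Matrix

/-! Criterion (1). The inequality is linear in `ρ` and the positive cone is convex, so pure states
suffice. If `ξ` and the test vector `x` have coefficient matrices `M` and `X`, put `C = X* M`, of
rank at most `k`, and `A = -V C`. The three quadratic forms are `|tr C|²`, `tr(A Ā)` and `‖C‖²`
(Frobenius). The antisymmetrisation `B = A - Aᵀ` has rank at most `2k`, satisfies `tr(V* B) = -2 tr
C` because `V` is skew, and has `‖B‖² = 2‖C‖² - 2 Re tr(A Ā)`. Cauchy–Schwarz on the column space of
`B` gives `|tr(V* B)|² ≤ rank B · ‖B‖²`, which is the claim (`norm_trace_sq_add_le`).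

Region (2). A local unitary turns the pair `F^V`, `ω` into the flip `F` and the normalised vector of
`Ω` (`exists_standard_position`, from the unitary congruence of all skew-symmetric unitaries). Both
overlaps are then invariant under `S ⊗ S` with `S` unitary and `S Ω Sᵀ = Ω`. Instead of a Haar
average, the element of least Frobenius norm in `SN_k` with the prescribed overlaps is taken: it
exists by compactness, is unique by strict convexity, hence is invariant (`exists_invariant`).

A Hermitian invariant operator is a combination of `1`, `F` and the projection on `Ω`
(`IsSymplecticInvariant.exists_decomposition`). To see this, rotations with phases `c`, `c̄` on a
line and its symplectic partner show that each `u ⊗ u` is an eigenvector, and that the span of `u ⊗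
v` and `v ⊗ u` is stable for `u, v` orthogonal and isotropic. Polarisation settles the symmetric
tensors; well-chosen isotropic pairs settle the antisymmetric ones. The trace and the two overlaps
fix the three coefficients, and conjugation by `I ⊗ Ω` produces `ρ_{a,b}`. -/

/-! ### Compactness of convex hulls in finite dimension -/

theorem sum_eq_sum_comp_embedding {ι κ M : Type*} [Fintype ι] [Fintype κ] [AddCommMonoid M]
    (e : ι ↪ κ) (g : κ → M) (hg : ∀ j, (¬ ∃ i, e i = j) → g j = 0) :
    ∑ j, g j = ∑ i, g (e i) := by
  rw [← Finset.sum_map Finset.univ e g]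
  symm
  apply Finset.sum_subset (Finset.subset_univ _)
  intro j _ hj
  apply hg
  simpa using hj

/-- By Carathéodory, `dim + 1` points always suffice, so the hull is the continuous image of a
simplex times a power of `s`. -/
theorem IsCompact.convexHull_of_finiteDimensional {E : Type*} [AddCommGroup E] [Module ℝ E]
    [TopologicalSpace E] [ContinuousAdd E] [ContinuousSMul ℝ E] [FiniteDimensional ℝ E]
    {s : Set E} (hs : IsCompact s) : IsCompact (convexHull ℝ s) := by
  set m := Module.finrank ℝ E + 1
  let f : (Fin m → ℝ) × (Fin m → E) → E := fun p => ∑ i, p.1 i • p.2 i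
  have hf : Continuous f := by fun_prop
  have hc : IsCompact (stdSimplex ℝ (Fin m) ×ˢ Set.univ.pi fun _ : Fin m => s) :=
    (isCompact_stdSimplex ℝ (Fin m)).prod (isCompact_univ_pi fun _ => hs)
  convert hc.image hf using 1
  apply Set.Subset.antisymm
  · intro x hx
    obtain ⟨ι, _, z, w, hz, hai, hw0, hw1, rfl⟩ := eq_pos_convex_span_of_mem_convexHull hx
    have hcard : Fintype.card ι ≤ Fintype.card (Fin m) := by
      simpa [m] using hai.card_le_finrank_succ.trans
        (Nat.succ_le_succ (Submodule.finrank_le _))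
    obtain ⟨e⟩ := Function.Embedding.nonempty_of_card_le hcard
    have hne : Nonempty ι := by
      by_contra h
      rw [not_nonempty_iff] at h
      simp at hw1
    obtain ⟨i₀⟩ := hne
    -- Carathéodory may use fewer than `m` points; the unused slots get weight `0` and the point `z
    -- i₀` of `s` as filler.
    refine ⟨(Function.extend e w 0, Function.extend e z fun _ => z i₀), ⟨⟨?_, ?_⟩, ?_⟩, ?_⟩
    · intro j
      by_cases h : ∃ i, e i = j
      · obtain ⟨i, rfl⟩ := h
        simpa [e.injective.extend_apply] using (hw0 i).le
      · simp [Function.extend_apply' _ _ _ h]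
    · rw [sum_eq_sum_comp_embedding e _ fun j h => by simp [Function.extend_apply' _ _ _ h]]
      simpa [e.injective.extend_apply] using hw1
    · intro j _
      by_cases h : ∃ i, e i = j
      · obtain ⟨i, rfl⟩ := h
        simpa [e.injective.extend_apply] using hz ⟨i, rfl⟩
      · simpa [Function.extend_apply' _ _ _ h] using hz ⟨i₀, rfl⟩
    · simp only [f]
      rw [sum_eq_sum_comp_embedding e _ fun j h => by simp [Function.extend_apply' _ _ _ h]]
      simp [e.injective.extend_apply]
  · rintro _ ⟨⟨w, z⟩, ⟨⟨hw0, hw1⟩, hz⟩, rfl⟩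
    exact (convex_convexHull ℝ s).sum_mem (fun i _ => hw0 i) hw1
      fun i _ => subset_convexHull ℝ s (hz i trivial)

/-! ### The sets `SN_k`: nesting, local unitary invariance, compactness -/

section SchmidtSet

variable {d : ℕ}

theorem schmidtSet_mono {k l : ℕ} (h : k ≤ l) : schmidtSet d k ⊆ schmidtSet d l :=
  convexHull_mono fun _ ⟨ξ, h1, ⟨r, hr, h2⟩, h3⟩ => ⟨ξ, h1, ⟨r, hr.trans h, h2⟩, h3⟩

theorem mem_schmidtSet_of_schmidtNumber_le {ρ : BipartiteMatrix d} {k : ℕ}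
    (h : schmidtNumber ρ ≤ k) : ρ ∈ schmidtSet d k := by
  by_contra hk
  have : ((k + 1 : ℕ) : ℕ∞) ≤ schmidtNumber ρ := by
    refine le_iInf₂ fun j hj => ?_
    by_contra hlt
    have hlt' : j < k + 1 := by exact_mod_cast not_le.mp hlt
    exact hk (schmidtSet_mono (Nat.lt_succ_iff.mp hlt') hj)
  have h2 := this.trans h
  have : k + 1 ≤ k := by exact_mod_cast h2
  omega

/-- The coefficient matrix of a bipartite vector. -/
def coeffMatrix (ξ : BipartiteVector d) : Matrix (Fin d) (Fin d) ℂ :=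
  Matrix.of fun x y => ξ (x, y)

/-- The matrix whose rows are the given vectors. -/
def rowsMatrix {r : ℕ} (v : Fin r → EuclideanSpace ℂ (Fin d)) : Matrix (Fin r) (Fin d) ℂ :=
  Matrix.of fun i x => v i x

theorem orthonormal_iff_rowsMatrix {r : ℕ} (v : Fin r → EuclideanSpace ℂ (Fin d)) :
    Orthonormal ℂ v ↔ rowsMatrix v * (rowsMatrix v)ᴴ = 1 := by
  rw [orthonormal_iff_ite]
  constructor
  · intro h
    ext i j
    have := h j i
    simp only [PiLp.inner_apply, RCLike.inner_apply] at this
    simpa [Matrix.mul_apply, rowsMatrix, Matrix.one_apply, eq_comm] using this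
  · intro h i j
    have := congrFun (congrFun h j) i
    simp only [PiLp.inner_apply, RCLike.inner_apply]
    simpa [Matrix.mul_apply, rowsMatrix, Matrix.one_apply, eq_comm] using this

/-- A Schmidt decomposition is a singular value factorisation of the coefficient matrix, so rank
bounds, norms and local unitaries become matrix algebra. -/
theorem coeffMatrix_eq_iff {r : ℕ} (ξ : BipartiteVector d) (c : Fin r → ℝ)
    (v w : Fin r → EuclideanSpace ℂ (Fin d)) :
    (∀ x y : Fin d, ξ (x, y) = ∑ i, (c i : ℂ) * (v i x * w i y)) ↔
      coeffMatrix ξ = (rowsMatrix v)ᵀ * Matrix.diagonal (fun i => (c i : ℂ)) * rowsMatrix w := by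
  have key : ∀ x y, ((rowsMatrix v)ᵀ * Matrix.diagonal (fun i => (c i : ℂ)) * rowsMatrix w) x y
      = ∑ i, (c i : ℂ) * (v i x * w i y) := by
    intro x y
    rw [Matrix.mul_apply]
    refine Finset.sum_congr rfl fun i _ => ?_
    rw [Matrix.mul_diagonal]
    simp only [rowsMatrix, Matrix.transpose_apply, Matrix.of_apply]
    ring
  constructor
  · intro h
    ext x y
    rw [key]
    exact h x y
  · intro h x y
    rw [← key, ← h]
    rfl

theorem HasSchmidtRank.rank_le {ξ : BipartiteVector d} {r : ℕ} (h : HasSchmidtRank ξ r) :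
    (coeffMatrix ξ).rank ≤ r := by
  obtain ⟨c, v, w, -, -, -, hξ⟩ := h
  rw [(coeffMatrix_eq_iff ξ c v w).1 hξ]
  exact (Matrix.rank_mul_le_right _ _).trans (Matrix.rank_le_height _)

theorem trace_pureState (ξ : BipartiteVector d) : (pureState ξ).trace = ((‖ξ‖ ^ 2 : ℝ) : ℂ) := by
  rw [EuclideanSpace.norm_sq_eq]
  simp [Matrix.trace, pureState, Complex.mul_conj, Complex.normSq_eq_norm_sq]

theorem pureState_eq (ξ : BipartiteVector d) :
    pureState ξ = vecMulVec ξ.ofLp (star ξ.ofLp) := rfl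

/-- The action of a matrix on bipartite vectors. -/
def actVec (U : BipartiteMatrix d) (ξ : BipartiteVector d) : BipartiteVector d :=
  WithLp.toLp 2 (U *ᵥ ξ.ofLp)

theorem pureState_actVec (U : BipartiteMatrix d) (ξ : BipartiteVector d) :
    pureState (actVec U ξ) = U * pureState ξ * Uᴴ := by
  simp [pureState_eq, actVec, Matrix.mul_vecMulVec, Matrix.vecMulVec_mul, Matrix.star_mulVec]

theorem coeffMatrix_actVec (A B : Matrix (Fin d) (Fin d) ℂ) (ξ : BipartiteVector d) :
    coeffMatrix (actVec (A ⊗ₖ B) ξ) = A * coeffMatrix ξ * Bᵀ := by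
  ext x y
  simp only [coeffMatrix, actVec, Matrix.mul_apply, Matrix.of_apply, Matrix.mulVec, dotProduct,
    Fintype.sum_prod_type, Matrix.transpose_apply, Finset.sum_mul, Matrix.kroneckerMap_apply]
  rw [Finset.sum_comm]
  exact Finset.sum_congr rfl fun i _ => Finset.sum_congr rfl fun j _ => by ring

theorem orthonormal_act {r : ℕ} {A : Matrix (Fin d) (Fin d) ℂ}
    (hA : Aᴴ * A = 1) {v : Fin r → EuclideanSpace ℂ (Fin d)} (hv : Orthonormal ℂ v) :
    Orthonormal ℂ (fun i => WithLp.toLp 2 (A *ᵥ (v i).ofLp) : Fin r → EuclideanSpace ℂ (Fin d)) ∧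
    rowsMatrix (fun i => WithLp.toLp 2 (A *ᵥ (v i).ofLp) : Fin r → EuclideanSpace ℂ (Fin d))
      = rowsMatrix v * Aᵀ := by
  have key : rowsMatrix (fun i => WithLp.toLp 2 (A *ᵥ (v i).ofLp) :
      Fin r → EuclideanSpace ℂ (Fin d)) = rowsMatrix v * Aᵀ := by
    ext i x
    simp [rowsMatrix, Matrix.mul_apply, Matrix.mulVec, dotProduct, mul_comm]
  refine ⟨?_, key⟩
  rw [orthonormal_iff_rowsMatrix, key, Matrix.conjTranspose_mul]
  have h1 : Aᵀ * (Aᵀ)ᴴ = 1 := by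
    have := congrArg Matrix.transpose hA
    simpa [Matrix.transpose_mul, Matrix.conjTranspose, Matrix.transpose_map] using this
  rw [Matrix.mul_assoc, ← Matrix.mul_assoc Aᵀ, h1, Matrix.one_mul,
    (orthonormal_iff_rowsMatrix v).1 hv]

theorem HasSchmidtRank.actVec {A B : Matrix (Fin d) (Fin d) ℂ} (hA : Aᴴ * A = 1)
    (hB : Bᴴ * B = 1) {ξ : BipartiteVector d} {r : ℕ} (h : HasSchmidtRank ξ r) :
    HasSchmidtRank (actVec (A ⊗ₖ B) ξ) r := by
  obtain ⟨c, v, w, hc, hv, hw, hξ⟩ := h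
  refine ⟨c, _, _, hc, (orthonormal_act hA hv).1, (orthonormal_act hB hw).1, ?_⟩
  rw [coeffMatrix_eq_iff, coeffMatrix_actVec, (coeffMatrix_eq_iff ξ c v w).1 hξ,
    (orthonormal_act hA hv).2, (orthonormal_act hB hw).2]
  simp [Matrix.mul_assoc]

theorem kronecker_unitary {A B : Matrix (Fin d) (Fin d) ℂ} (hA : Aᴴ * A = 1)
    (hB : Bᴴ * B = 1) : (A ⊗ₖ B)ᴴ * (A ⊗ₖ B) = 1 := by
  rw [Matrix.conjTranspose_kronecker, ← Matrix.mul_kronecker_mul, hA, hB,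
    Matrix.one_kronecker_one]

/-- Conjugation `σ ↦ U σ U^*` as a real linear map. -/
def conjLinear (U : BipartiteMatrix d) : BipartiteMatrix d →ₗ[ℝ] BipartiteMatrix d where
  toFun σ := U * σ * Uᴴ
  map_add' := by intros; simp [Matrix.mul_add, Matrix.add_mul]
  map_smul' := by intros; simp

/-- A local unitary carries orthonormal families to orthonormal families and keeps the coefficients.
This serves the reduction to standard position, the symmetrisation and the final conjugation by `I ⊗
Ω`. -/
theorem schmidtSet_conj {A B : Matrix (Fin d) (Fin d) ℂ} (hA : Aᴴ * A = 1)
    (hB : Bᴴ * B = 1) {k : ℕ} {σ : BipartiteMatrix d} (hσ : σ ∈ schmidtSet d k) :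
    (A ⊗ₖ B) * σ * (A ⊗ₖ B)ᴴ ∈ schmidtSet d k := by
  have : schmidtSet d k ⊆ conjLinear (A ⊗ₖ B) ⁻¹' schmidtSet d k := by
    refine convexHull_min ?_ ((convex_convexHull ℝ _).linear_preimage _)
    rintro _ ⟨ξ, h1, ⟨r, hr, h2⟩, rfl⟩
    refine subset_convexHull ℝ _ ⟨actVec (A ⊗ₖ B) ξ, ?_, ⟨r, hr, h2.actVec hA hB⟩, ?_⟩
    · have h3 := trace_pureState (actVec (A ⊗ₖ B) ξ)
      rw [pureState_actVec, Matrix.trace_mul_comm, ← Matrix.mul_assoc, kronecker_unitary hA hB,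
        Matrix.one_mul, trace_pureState, h1] at h3
      have h4 : ‖actVec (A ⊗ₖ B) ξ‖ ^ 2 = 1 ^ 2 := by exact_mod_cast h3.symm
      have := norm_nonneg (actVec (A ⊗ₖ B) ξ)
      nlinarith
    · exact (pureState_actVec _ _).symm
  exact this hσ

theorem trace_of_mem_schmidtSet {k : ℕ} {σ : BipartiteMatrix d} (hσ : σ ∈ schmidtSet d k) :
    σ.trace = 1 := by
  have : schmidtSet d k ⊆ {σ | σ.trace = 1} := by
    refine convexHull_min ?_ ?_
    · rintro _ ⟨ξ, h1, -, rfl⟩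
      simp [trace_pureState, h1]
    · intro x hx y hy a b _ _ hab
      simp only [Set.mem_ofPred_eq] at hx hy ⊢
      rw [Matrix.trace_add, Matrix.trace_smul, Matrix.trace_smul, hx, hy, ← add_smul, hab, one_smul]
  exact this hσ

theorem isHermitian_of_mem_schmidtSet {k : ℕ} {σ : BipartiteMatrix d} (hσ : σ ∈ schmidtSet d k) :
    σ.IsHermitian := by
  have : schmidtSet d k ⊆ {σ | σ.IsHermitian} := by
    refine convexHull_min ?_ ?_
    · rintro _ ⟨ξ, -, -, rfl⟩
      ext p q
      simp [pureState, mul_comm]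
    · intro x hx y hy a b _ _ _
      simp only [Set.mem_ofPred_eq, Matrix.IsHermitian] at hx hy ⊢
      simp [Matrix.conjTranspose_add, Matrix.conjTranspose_smul, hx, hy]
  exact this hσ

/-- Schmidt data with nonnegative coefficients. -/
abbrev SchmidtData (d r : ℕ) : Type :=
  (Fin r → ℝ) × (Fin r → EuclideanSpace ℂ (Fin d)) × (Fin r → EuclideanSpace ℂ (Fin d))

/-- The vector `∑ i, c i • (v i ⊗ w i)`. -/
noncomputable def schmidtVector {r : ℕ} (p : SchmidtData d r) : BipartiteVector d :=
  WithLp.toLp 2 fun q => ∑ i, (p.1 i : ℂ) * (p.2.1 i q.1 * p.2.2 i q.2)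

/-- Normalised Schmidt data. -/
def normalizedSchmidtData (d r : ℕ) : Set (SchmidtData d r) :=
  {p | (∀ i, 0 ≤ p.1 i) ∧ ∑ i, p.1 i ^ 2 = 1 ∧ Orthonormal ℂ p.2.1 ∧ Orthonormal ℂ p.2.2}

theorem norm_schmidtVector {r : ℕ} (c : Fin r → ℝ) {v w : Fin r → EuclideanSpace ℂ (Fin d)}
    (hv : Orthonormal ℂ v) (hw : Orthonormal ℂ w) :
    ‖schmidtVector (c, v, w)‖ ^ 2 = ∑ i, c i ^ 2 := by
  set ξ := schmidtVector (c, v, w)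
  set M := coeffMatrix ξ
  have hM : M = (rowsMatrix v)ᵀ * Matrix.diagonal (fun i => (c i : ℂ)) * rowsMatrix w :=
    (coeffMatrix_eq_iff ξ c v w).1 fun x y => rfl
  have hv' := (orthonormal_iff_rowsMatrix v).1 hv
  have hw' := (orthonormal_iff_rowsMatrix w).1 hw
  have h1 : ((‖ξ‖ ^ 2 : ℝ) : ℂ) = (M * Mᴴ).trace := by
    rw [EuclideanSpace.norm_sq_eq, Fintype.sum_prod_type]
    simp [Matrix.trace, Matrix.mul_apply, M, coeffMatrix, Complex.mul_conj,
      Complex.normSq_eq_norm_sq]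
  have hvT : (rowsMatrix v)ᵀᴴ * (rowsMatrix v)ᵀ = 1 := by
    have := congrArg Matrix.transpose hv'
    simpa [Matrix.transpose_mul, Matrix.conjTranspose, Matrix.transpose_map] using this
  have h2 : (M * Mᴴ).trace = ∑ i, ((c i : ℂ)) ^ 2 := by
    rw [hM]
    simp only [Matrix.conjTranspose_mul, Matrix.mul_assoc]
    rw [← Matrix.mul_assoc (rowsMatrix w), hw', Matrix.one_mul, Matrix.trace_mul_comm]
    simp only [Matrix.mul_assoc]
    rw [hvT, Matrix.mul_one, Matrix.diagonal_conjTranspose, Matrix.diagonal_mul_diagonal,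
      Matrix.trace_diagonal]
    exact Finset.sum_congr rfl fun i _ => by simp [sq]
  exact_mod_cast h1.trans h2

theorem isCompact_normalizedSchmidtData (d r : ℕ) : IsCompact (normalizedSchmidtData d r) := by
  refine Metric.isCompact_of_isClosed_isBounded ?_ ?_
  · have : normalizedSchmidtData d r = {p | (∀ i, 0 ≤ p.1 i)} ∩ ({p | ∑ i, p.1 i ^ 2 = 1} ∩
        ({p | ∀ i j, inner ℂ (p.2.1 i) (p.2.1 j) = if i = j then (1 : ℂ) else 0} ∩
        {p | ∀ i j, inner ℂ (p.2.2 i) (p.2.2 j) = if i = j then (1 : ℂ) else 0})) := by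
      ext p
      simp [normalizedSchmidtData, orthonormal_iff_ite]
    rw [this]
    refine IsClosed.inter ?_ (IsClosed.inter ?_ (IsClosed.inter ?_ ?_))
    · simp only [Set.ofPred_forall]
      exact isClosed_iInter fun i => isClosed_le continuous_const (by fun_prop)
    · exact isClosed_eq (by fun_prop) continuous_const
    · simp only [Set.ofPred_forall]
      exact isClosed_iInter fun i => isClosed_iInter fun j =>
        isClosed_eq (by fun_prop) continuous_const
    · simp only [Set.ofPred_forall]
      exact isClosed_iInter fun i => isClosed_iInter fun j =>
        isClosed_eq (by fun_prop) continuous_const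
  · refine (Metric.isBounded_closedBall (x := (0 : SchmidtData d r)) (r := 1)).subset ?_
    rintro ⟨c, v, w⟩ ⟨h0, h1, hv, hw⟩
    simp only [mem_closedBall_zero_iff, Prod.norm_def, sup_le_iff]
    refine ⟨?_, ?_, ?_⟩
    · refine (pi_norm_le_iff_of_nonneg zero_le_one).2 fun i => ?_
      rw [Real.norm_eq_abs, ← sq_le_one_iff_abs_le_one, ← h1]
      exact Finset.single_le_sum (f := fun i => c i ^ 2) (fun j _ => sq_nonneg _)
        (Finset.mem_univ i)
    · exact (pi_norm_le_iff_of_nonneg zero_le_one).2 fun i => (hv.1 i).le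
    · exact (pi_norm_le_iff_of_nonneg zero_le_one).2 fun i => (hw.1 i).le

theorem continuous_pureState_schmidtVector (d r : ℕ) :
    Continuous fun p : SchmidtData d r => pureState (schmidtVector p) := by
  unfold pureState schmidtVector
  refine continuous_matrix fun i j => ?_
  simp only [Matrix.of_apply]
  fun_prop

/-- Dropping vanishing coefficients from Schmidt data gives a Schmidt decomposition. -/
theorem exists_hasSchmidtRank_schmidtVector {r : ℕ} {p : SchmidtData d r}
    (hp : p ∈ normalizedSchmidtData d r) : ∃ m ≤ r, HasSchmidtRank (schmidtVector p) m := by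
  obtain ⟨c, v, w⟩ := p
  obtain ⟨h0, -, hv, hw⟩ := hp
  simp only at h0 hv hw
  set ι := {i // c i ≠ 0}
  have e : Fin (Fintype.card ι) ≃ ι := (Fintype.equivFin ι).symm
  have hinj : Function.Injective fun i => (e i : Fin r) :=
    Subtype.val_injective.comp e.injective
  refine ⟨Fintype.card ι, (Fintype.card_subtype_le fun i => c i ≠ 0).trans (Fintype.card_fin r).le,
    fun i => c (e i), fun i => v (e i), fun i => w (e i),
    fun i => lt_of_le_of_ne (h0 _) (e i).2.symm, hv.comp _ hinj, hw.comp _ hinj, ?_⟩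
  intro x y
  rw [e.sum_comp (fun i : ι => ((c i : ℝ) : ℂ) * (v i x * w i y))]
  change ∑ i, (c i : ℂ) * (v i x * w i y) = _
  refine sum_eq_sum_comp_embedding (Function.Embedding.subtype fun i => c i ≠ 0) _ fun j hj => ?_
  have : c j = 0 := by
    by_contra h
    exact hj ⟨⟨j, h⟩, rfl⟩
  simp [this]

/-- Strict positivity of Schmidt coefficients is not a closed condition. Allowing zeros makes the
data of each length compact, and dropping zeros only lowers the rank, so the generators are a finite
union over `r ≤ k` of compact images. -/
theorem isCompact_schmidtSet (d k : ℕ) : IsCompact (schmidtSet d k) := by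
  refine IsCompact.convexHull_of_finiteDimensional ?_
  have hc : IsCompact (⋃ r ∈ Set.Iic k,
      (fun p : SchmidtData d r => pureState (schmidtVector p)) '' normalizedSchmidtData d r) :=
    (Set.finite_Iic k).isCompact_biUnion fun r _ =>
      (isCompact_normalizedSchmidtData d r).image (continuous_pureState_schmidtVector d r)
  convert hc using 1
  ext σ
  simp only [Set.mem_ofPred_eq, Set.mem_iUnion, Set.mem_image, Set.mem_Iic]
  constructor
  · rintro ⟨ξ, h1, ⟨r, hr, c, v, w, hc, hv, hw, hξ⟩, rfl⟩
    have : ξ = schmidtVector (c, v, w) := by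
      ext q
      exact hξ q.1 q.2
    refine ⟨r, hr, (c, v, w), ⟨fun i => (hc i).le, ?_, hv, hw⟩, by rw [this]⟩
    rw [← norm_schmidtVector c hv hw, ← this, h1, one_pow]
  · rintro ⟨r, hr, p, hp, rfl⟩
    obtain ⟨m, hm, h⟩ := exists_hasSchmidtRank_schmidtVector hp
    refine ⟨_, ?_, ⟨m, hm.trans hr, h⟩, rfl⟩
    have h1 := norm_schmidtVector p.1 hp.2.2.1 hp.2.2.2
    rw [hp.2.1] at h1
    have h2 := norm_nonneg (schmidtVector (p.1, p.2.1, p.2.2))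
    change ‖schmidtVector (p.1, p.2.1, p.2.2)‖ = 1
    nlinarith

end SchmidtSet

/-! ### Cauchy–Schwarz for the Frobenius pairing -/

theorem trace_mul_conjTranspose_eq_sum {m n : Type*} [Fintype m] [Fintype n] (A : Matrix m n ℂ) :
    (A * Aᴴ).trace = ((∑ p : m × n, ‖A p.1 p.2‖ ^ 2 : ℝ) : ℂ) := by
  rw [Fintype.sum_prod_type]
  simp [Matrix.trace, Matrix.mul_apply, Complex.mul_conj, Complex.normSq_eq_norm_sq]

theorem norm_trace_mul_conjTranspose_sq_le {m n : Type*} [Fintype m] [Fintype n]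
    (X Y : Matrix m n ℂ) :
    ‖(Y * Xᴴ).trace‖ ^ 2 ≤ (X * Xᴴ).trace.re * (Y * Yᴴ).trace.re := by
  let x : EuclideanSpace ℂ (m × n) := WithLp.toLp 2 fun p => X p.1 p.2
  let y : EuclideanSpace ℂ (m × n) := WithLp.toLp 2 fun p => Y p.1 p.2
  have h1 : (Y * Xᴴ).trace = inner ℂ x y := by
    simp only [PiLp.inner_apply, RCLike.inner_apply, Fintype.sum_prod_type]
    simp [Matrix.trace, Matrix.mul_apply, x, y]
  have h2 : (X * Xᴴ).trace.re = ‖x‖ ^ 2 := by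
    rw [trace_mul_conjTranspose_eq_sum, EuclideanSpace.norm_sq_eq, Complex.ofReal_re]
  have h3 : (Y * Yᴴ).trace.re = ‖y‖ ^ 2 := by
    rw [trace_mul_conjTranspose_eq_sum, EuclideanSpace.norm_sq_eq, Complex.ofReal_re]
  rw [h1, h2, h3, ← mul_pow]
  exact pow_le_pow_left₀ (norm_nonneg _) (norm_inner_le_norm x y) 2

/-! ### The positivity criterion -/

section Criterion

variable {d : ℕ}

/-- Every matrix factors through an isometry whose width is its rank. -/
theorem exists_isometry_mul_eq (B : Matrix (Fin d) (Fin d) ℂ) :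
    ∃ E : Matrix (Fin d) (Fin B.rank) ℂ, Eᴴ * E = 1 ∧ E * (Eᴴ * B) = B := by
  set S : Submodule ℂ (EuclideanSpace ℂ (Fin d)) :=
    (Submodule.span ℂ (Set.range B.col)).map
      (WithLp.linearEquiv 2 ℂ (Fin d → ℂ)).symm.toLinearMap
  have hr : Module.finrank ℂ S = B.rank := by
    rw [Matrix.rank_eq_finrank_span_cols]
    exact LinearEquiv.finrank_map_eq _ _
  let b := (stdOrthonormalBasis ℂ S).reindex (finCongr hr)
  have hb : Orthonormal ℂ fun i => (b i : EuclideanSpace ℂ (Fin d)) :=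
    b.orthonormal.comp_linearIsometry S.subtypeₗᵢ
  refine ⟨Matrix.of fun x i => (b i : EuclideanSpace ℂ (Fin d)) x, ?_, ?_⟩
  · ext i j
    have := orthonormal_iff_ite.1 hb i j
    simp only [PiLp.inner_apply, RCLike.inner_apply] at this
    simpa [Matrix.mul_apply, Matrix.one_apply, mul_comm] using this
  · ext x j
    have hj : WithLp.toLp 2 (B.col j) ∈ S :=
      Submodule.mem_map_of_mem (Submodule.subset_span ⟨j, rfl⟩)
    have h1 := b.sum_repr' ⟨_, hj⟩
    have h2 := congrArg (fun v : S => (v : EuclideanSpace ℂ (Fin d)) x) h1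
    simp only [Submodule.coe_inner, PiLp.inner_apply, RCLike.inner_apply, Submodule.coe_sum,
      Submodule.coe_smul, WithLp.ofLp_sum, Finset.sum_apply, PiLp.smul_apply,
      smul_eq_mul, Matrix.col_apply] at h2
    rw [← h2]
    simp only [Matrix.mul_apply, Matrix.of_apply, Matrix.conjTranspose_apply]
    refine Finset.sum_congr rfl fun i _ => ?_
    rw [mul_comm]
    congr 1
    exact Finset.sum_congr rfl fun y _ => by rw [mul_comm]; rfl

/-- The pairing of a matrix with a unitary is controlled by the rank and the Frobenius norm. -/
theorem norm_trace_unitary_sq_le {V : Matrix (Fin d) (Fin d) ℂ} (hV : V * Vᴴ = 1)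
    (B : Matrix (Fin d) (Fin d) ℂ) :
    ‖(Vᴴ * B).trace‖ ^ 2 ≤ B.rank * (B * Bᴴ).trace.re := by
  obtain ⟨E, hE, hEB⟩ := exists_isometry_mul_eq B
  -- Compressing to the column space of `B` leaves the pairing unchanged, while the squared norm of
  -- `V` drops from `d` to `rank B`.
  have h := norm_trace_mul_conjTranspose_sq_le (Eᴴ * V) (Eᴴ * B)
  have h1 : ((Eᴴ * B) * (Eᴴ * V)ᴴ).trace = (Vᴴ * B).trace := by
    rw [Matrix.trace_mul_comm, Matrix.conjTranspose_mul, Matrix.conjTranspose_conjTranspose,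
      Matrix.mul_assoc, hEB]
  have h2 : ((Eᴴ * V) * (Eᴴ * V)ᴴ).trace = B.rank := by
    rw [Matrix.conjTranspose_mul, Matrix.conjTranspose_conjTranspose, Matrix.mul_assoc,
      ← Matrix.mul_assoc V, hV, Matrix.one_mul, hE, Matrix.trace_one, Fintype.card_fin]
  have h3 : ((Eᴴ * B) * (Eᴴ * B)ᴴ).trace = (B * Bᴴ).trace := by
    rw [Matrix.trace_mul_comm, Matrix.conjTranspose_mul, Matrix.conjTranspose_conjTranspose,
      Matrix.mul_assoc, hEB, Matrix.trace_mul_comm]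
  rw [h1, h2, h3] at h
  simpa using h

theorem rank_sub_transpose_le (A : Matrix (Fin d) (Fin d) ℂ) :
    (A - Aᵀ).rank ≤ 2 * A.rank := by
  have h1 : (A - Aᵀ).rank ≤ A.rank + (-Aᵀ).rank := by
    rw [sub_eq_add_neg]
    unfold Matrix.rank
    rw [Matrix.mulVecLin_add]
    refine (Submodule.finrank_mono (LinearMap.range_add_le _ _)).trans ?_
    exact Submodule.finrank_add_le_finrank_add_finrank _ _
  have h2 : (-Aᵀ).rank ≤ A.rank := by
    rw [← Matrix.rank_transpose A, neg_eq_neg_one_mul]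
    exact Matrix.rank_mul_le_right _ _
  omega

/-- The trace inequality behind the positivity criterion. -/
theorem norm_trace_sq_add_le {V C : Matrix (Fin d) (Fin d) ℂ} (hV : IsSkewUnitary V) {k : ℕ}
    (hC : C.rank ≤ k) :
    ‖C.trace‖ ^ 2 + k * ((-V * C) * (-V * C)ᵀᴴ).trace.re ≤ k * (C * Cᴴ).trace.re := by
  obtain ⟨hU, hskew⟩ := hV
  have hVV : V * Vᴴ = 1 := Matrix.mem_unitaryGroup_iff.1 hU
  have hVV' : Vᴴ * V = 1 := Matrix.mem_unitaryGroup_iff'.1 hU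
  set A := -V * C with hA
  have hrank : ((A - Aᵀ).rank : ℝ) ≤ 2 * k := by
    have : (A - Aᵀ).rank ≤ 2 * k :=
      (rank_sub_transpose_le A).trans (Nat.mul_le_mul_left 2
        ((Matrix.rank_mul_le_right _ _).trans hC))
    exact_mod_cast this
  have hCA : Vᴴ * A = -C := by rw [hA, ← Matrix.mul_assoc]; simp [hVV']
  -- Since `V` is skew, `tr(V* Aᵀ)` is the opposite of `tr(V* A) = -tr C`. The two terms of `A - Aᵀ`
  -- therefore reinforce each other, and the resulting factor 4 absorbs the doubled rank.
  have htr : (Vᴴ * Aᵀ).trace = C.trace := by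
    rw [← Matrix.trace_transpose, Matrix.transpose_mul, Matrix.transpose_transpose,
      Matrix.trace_mul_comm]
    have : Vᴴᵀ = -Vᴴ := by
      change Vᵀᴴ = _
      rw [hskew, Matrix.conjTranspose_neg]
    rw [this, Matrix.neg_mul, hCA, neg_neg]
  have h := norm_trace_unitary_sq_le hVV (A - Aᵀ)
  rw [Matrix.mul_sub, Matrix.trace_sub, htr, hCA, Matrix.trace_neg] at h
  have h1 : ‖-C.trace - C.trace‖ ^ 2 = 4 * ‖C.trace‖ ^ 2 := by
    rw [show -C.trace - C.trace = (-2 : ℂ) * C.trace by ring, norm_mul, mul_pow]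
    norm_num
  have hAA : (A * Aᴴ).trace = (C * Cᴴ).trace := by
    rw [Matrix.trace_mul_comm, hA, Matrix.conjTranspose_mul, Matrix.mul_assoc,
      ← Matrix.mul_assoc _ (-V), Matrix.conjTranspose_neg, _root_.neg_mul_neg, hVV',
      Matrix.one_mul, Matrix.trace_mul_comm]
  have e1 : (Aᵀ * Aᵀᴴ).trace = (A * Aᴴ).trace := by
    rw [← Matrix.trace_transpose, Matrix.transpose_mul, Matrix.transpose_transpose,
      Matrix.trace_mul_comm]
    change (A * Aᵀᴴᵀ).trace = _
    rfl
  have e2 : (Aᵀ * Aᴴ).trace = (A * Aᵀᴴ).trace := by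
    rw [← Matrix.trace_transpose, Matrix.transpose_mul, Matrix.transpose_transpose,
      Matrix.trace_mul_comm]
    rfl
  have h2 : ((A - Aᵀ) * (A - Aᵀ)ᴴ).trace.re
      = 2 * (C * Cᴴ).trace.re - 2 * (A * Aᵀᴴ).trace.re := by
    rw [Matrix.conjTranspose_sub, Matrix.sub_mul, Matrix.mul_sub, Matrix.mul_sub,
      Matrix.trace_sub, Matrix.trace_sub, Matrix.trace_sub, e1, e2, hAA]
    simp only [Complex.sub_re]
    ring
  have hnn : 0 ≤ ((A - Aᵀ) * (A - Aᵀ)ᴴ).trace.re := by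
    rw [trace_mul_conjTranspose_eq_sum, Complex.ofReal_re]
    positivity
  have h3 := h.trans (mul_le_mul_of_nonneg_right hrank hnn)
  rw [h1, h2] at h3
  linarith

/-- The coefficient matrix of a function on pairs. -/
abbrev toMat (x : Fin d × Fin d → ℂ) : Matrix (Fin d) (Fin d) ℂ := Matrix.of fun a b => x (a, b)

theorem toMat_kronecker_mulVec (A B : Matrix (Fin d) (Fin d) ℂ) (x : Fin d × Fin d → ℂ) :
    toMat ((A ⊗ₖ B) *ᵥ x) = A * toMat x * Bᵀ :=
  coeffMatrix_actVec A B (WithLp.toLp 2 x)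

theorem star_dotProduct_eq_trace (x y : Fin d × Fin d → ℂ) :
    star x ⬝ᵥ y = ((toMat x)ᴴ * toMat y).trace := by
  simp only [dotProduct, Fintype.sum_prod_type, Matrix.trace, Matrix.mul_apply, Matrix.diag_apply]
  rw [Finset.sum_comm]
  rfl

/-- This and the next quadratic forms see `x` and `ξ` only through `(toMat x)ᴴ * coeffMatrix ξ`,
which turns the operator inequality into a trace inequality for a single matrix of bounded rank. -/
theorem quadForm_pureState (ξ : BipartiteVector d) (x : Fin d × Fin d → ℂ) :
    star x ⬝ᵥ (pureState ξ *ᵥ x) = ((‖((toMat x)ᴴ * coeffMatrix ξ).trace‖ ^ 2 : ℝ) : ℂ) := by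
  rw [pureState_eq, Matrix.vecMulVec_mulVec, dotProduct_smul]
  have h1 : star x ⬝ᵥ ξ.ofLp = ((toMat x)ᴴ * coeffMatrix ξ).trace :=
    star_dotProduct_eq_trace x ξ.ofLp
  have h2 : star ξ.ofLp ⬝ᵥ x = star (star x ⬝ᵥ ξ.ofLp) := by
    rw [Matrix.star_dotProduct, dotProduct_comm]
  rw [h2, h1]
  simp [Complex.mul_conj, Complex.normSq_eq_norm_sq]

theorem reducedA_pureState (ξ : BipartiteVector d) :
    reducedA (pureState ξ) = coeffMatrix ξ * (coeffMatrix ξ)ᴴ := by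
  ext i j
  simp [reducedA, pureState, coeffMatrix, Matrix.mul_apply]

theorem quadForm_reducedA (ξ : BipartiteVector d) (x : Fin d × Fin d → ℂ) :
    star x ⬝ᵥ ((reducedA (pureState ξ) ⊗ₖ (1 : Matrix (Fin d) (Fin d) ℂ)) *ᵥ x)
      = (((toMat x)ᴴ * coeffMatrix ξ) * ((toMat x)ᴴ * coeffMatrix ξ)ᴴ).trace := by
  rw [star_dotProduct_eq_trace, toMat_kronecker_mulVec, reducedA_pureState]
  simp [Matrix.mul_assoc]

theorem quadForm_partialTranspose (ξ : BipartiteVector d) (x : Fin d × Fin d → ℂ) :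
    star x ⬝ᵥ (partialTranspose (pureState ξ) *ᵥ x)
      = (((toMat x)ᴴ * coeffMatrix ξ) * ((toMat x)ᴴ * coeffMatrix ξ)ᵀᴴ).trace := by
  simp only [dotProduct, Matrix.mulVec, Matrix.trace, Matrix.mul_apply, Matrix.diag_apply,
    Fintype.sum_prod_type, Matrix.conjTranspose_apply, Matrix.transpose_apply, partialTranspose,
    pureState, coeffMatrix, Matrix.of_apply, star_sum, star_mul', Finset.sum_mul, Finset.mul_sum,
    Pi.star_apply, star_star]
  rw [Finset.sum_comm]
  refine Finset.sum_congr rfl fun b _ => ?_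
  rw [Finset.sum_comm]
  conv_lhs => enter [2, p]; rw [Finset.sum_comm]
  rw [Finset.sum_comm]
  refine Finset.sum_congr rfl fun a _ => ?_
  exact Finset.sum_congr rfl fun p _ => Finset.sum_congr rfl fun q _ => by ring

/-- Moving `I ⊗ V` onto `x` multiplies `(toMat x)ᴴ` on the left by the transpose of `V`, which is
`-V`. -/
theorem quadForm_adRight_partialTranspose {V : Matrix (Fin d) (Fin d) ℂ} (hV : Vᵀ = -V)
    (ξ : BipartiteVector d) (x : Fin d × Fin d → ℂ) :
    star x ⬝ᵥ (adRight V (partialTranspose (pureState ξ)) *ᵥ x)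
      = ((-V * ((toMat x)ᴴ * coeffMatrix ξ)) * (-V * ((toMat x)ᴴ * coeffMatrix ξ))ᵀᴴ).trace := by
  set U := (1 : Matrix (Fin d) (Fin d) ℂ) ⊗ₖ V
  have h1 : star x ⬝ᵥ (adRight V (partialTranspose (pureState ξ)) *ᵥ x)
      = star (Uᴴ *ᵥ x) ⬝ᵥ (partialTranspose (pureState ξ) *ᵥ (Uᴴ *ᵥ x)) := by
    change star x ⬝ᵥ ((U * _ * Uᴴ) *ᵥ x) = _
    rw [Matrix.star_mulVec, Matrix.conjTranspose_conjTranspose, ← Matrix.dotProduct_mulVec,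
      Matrix.mulVec_mulVec, Matrix.mulVec_mulVec, Matrix.mul_assoc]
  have h2 : (toMat (Uᴴ *ᵥ x))ᴴ = -V * (toMat x)ᴴ := by
    have : Vᴴᵀᴴ = -V := by
      rw [← hV]
      ext i j
      simp
    rw [show Uᴴ = (1 : Matrix (Fin d) (Fin d) ℂ) ⊗ₖ Vᴴ by
      simp [U, Matrix.conjTranspose_kronecker], toMat_kronecker_mulVec, Matrix.one_mul,
      Matrix.conjTranspose_mul, this]
  rw [h1, quadForm_partialTranspose, h2, Matrix.mul_assoc (-V)]

theorem reducedA_isHermitian {ρ : BipartiteMatrix d} (h : ρ.IsHermitian) :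
    (reducedA ρ).IsHermitian := by
  ext i j
  simp only [reducedA, Matrix.conjTranspose_apply, Matrix.of_apply, star_sum]
  exact Finset.sum_congr rfl fun l _ => h.apply _ _

theorem partialTranspose_isHermitian {ρ : BipartiteMatrix d} (h : ρ.IsHermitian) :
    (partialTranspose ρ).IsHermitian := by
  ext p q
  exact h.apply _ _

theorem isHermitian_natCast_smul {n : Type*} {A : Matrix n n ℂ} (h : A.IsHermitian) (k : ℕ) :
    ((k : ℂ) • A).IsHermitian := by
  rw [Matrix.IsHermitian, Matrix.conjTranspose_smul, h.eq]
  simp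

theorem pureState_add_le {V : Matrix (Fin d) (Fin d) ℂ} (hV : IsSkewUnitary V) {k : ℕ}
    {ξ : BipartiteVector d} (hξ : (coeffMatrix ξ).rank ≤ k) :
    pureState ξ + (k : ℂ) • adRight V (partialTranspose (pureState ξ))
      ≤ (k : ℂ) • (reducedA (pureState ξ) ⊗ₖ (1 : Matrix (Fin d) (Fin d) ℂ)) := by
  have hρ : (pureState ξ).IsHermitian := by
    ext p q
    simp [pureState, mul_comm]
  rw [Matrix.le_iff]
  refine Matrix.PosSemidef.of_dotProduct_mulVec_nonneg ?_ fun x => ?_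
  · refine (isHermitian_natCast_smul ?_ k).sub (hρ.add (isHermitian_natCast_smul ?_ k))
    · rw [Matrix.IsHermitian, Matrix.conjTranspose_kronecker, (reducedA_isHermitian hρ).eq,
        Matrix.conjTranspose_one]
    · exact isHermitian_mul_mul_conjTranspose _ (partialTranspose_isHermitian hρ)
  · set C := (toMat x)ᴴ * coeffMatrix ξ with hCdef
    have hC : C.rank ≤ k := (Matrix.rank_mul_le_right _ _).trans hξ
    have h := norm_trace_sq_add_le hV hC
    -- By cyclicity `tr(A Ā)` equals its own conjugate, so the bound on its real part is a bound on
    -- the number itself.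
    have hreal : ((-V * C) * (-V * C)ᵀᴴ).trace
        = ((((-V * C) * (-V * C)ᵀᴴ).trace.re : ℝ) : ℂ) := by
      refine (Complex.conj_eq_iff_re.1 ?_).symm
      change star _ = _
      rw [← Matrix.trace_conjTranspose, Matrix.conjTranspose_mul,
        Matrix.conjTranspose_conjTranspose, ← Matrix.trace_transpose, Matrix.transpose_mul,
        Matrix.transpose_transpose, Matrix.trace_mul_comm]
      rfl
    have hreal2 : (C * Cᴴ).trace = (((C * Cᴴ).trace.re : ℝ) : ℂ) := by
      rw [trace_mul_conjTranspose_eq_sum, Complex.ofReal_re]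
    rw [Matrix.sub_mulVec, Matrix.add_mulVec, Matrix.smul_mulVec, Matrix.smul_mulVec,
      dotProduct_sub, dotProduct_add, dotProduct_smul, dotProduct_smul, quadForm_pureState,
      quadForm_reducedA, quadForm_adRight_partialTranspose hV.2, ← hCdef, hreal, hreal2]
    simp only [smul_eq_mul]
    have h' : 0 ≤ (k : ℝ) * (C * Cᴴ).trace.re
        - (‖C.trace‖ ^ 2 + k * ((-V * C) * (-V * C)ᵀᴴ).trace.re) := by linarith
    exact_mod_cast Complex.zero_le_real.2 h'

/-- The map `ρ ↦ k ρ_A ⊗ I - ρ - k Ad_{I ⊗ V}(ρ^Γ)`. -/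
def criterionMap (V : Matrix (Fin d) (Fin d) ℂ) (k : ℕ) :
    BipartiteMatrix d →ₗ[ℝ] BipartiteMatrix d where
  toFun ρ := (k : ℂ) • (reducedA ρ ⊗ₖ (1 : Matrix (Fin d) (Fin d) ℂ))
    - (ρ + (k : ℂ) • adRight V (partialTranspose ρ))
  map_add' ρ τ := by
    have h1 : reducedA (ρ + τ) = reducedA ρ + reducedA τ := by
      ext i j; simp [reducedA, Finset.sum_add_distrib]
    have h2 : partialTranspose (ρ + τ) = partialTranspose ρ + partialTranspose τ := by
      ext i j; simp [partialTranspose]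
    rw [h1, h2, Matrix.add_kronecker, adRight, adRight, adRight, Matrix.mul_add, Matrix.add_mul,
      smul_add, smul_add]
    abel
  map_smul' c ρ := by
    have h1 : reducedA (c • ρ) = c • reducedA ρ := by
      ext i j; simp [reducedA, Finset.mul_sum]
    have h2 : partialTranspose (c • ρ) = c • partialTranspose ρ := by
      ext i j; simp [partialTranspose]
    rw [h1, h2, Matrix.smul_kronecker, adRight, adRight, Matrix.mul_smul, Matrix.smul_mul,
      smul_comm (k : ℂ) c, smul_comm (k : ℂ) c, RingHom.id_apply, smul_sub, smul_add]

theorem add_le_of_mem_schmidtSet {V : Matrix (Fin d) (Fin d) ℂ} (hV : IsSkewUnitary V) {k : ℕ}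
    {ρ : BipartiteMatrix d} (hρ : ρ ∈ schmidtSet d k) :
    ρ + (k : ℂ) • adRight V (partialTranspose ρ)
      ≤ (k : ℂ) • (reducedA ρ ⊗ₖ (1 : Matrix (Fin d) (Fin d) ℂ)) := by
  have hconv : Convex ℝ {A : BipartiteMatrix d | A.PosSemidef} := by
    intro A hA B hB a b ha hb _
    exact (Matrix.PosSemidef.smul hA ha).add (Matrix.PosSemidef.smul hB hb)
  have : schmidtSet d k ⊆ criterionMap V k ⁻¹' {A | A.PosSemidef} := by
    refine convexHull_min ?_ (hconv.linear_preimage _)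
    rintro _ ⟨ξ, -, ⟨r, hr, h⟩, rfl⟩
    exact Matrix.le_iff.1 (pureState_add_le hV (h.rank_le.trans hr))
  exact Matrix.le_iff.2 (this hρ)

end Criterion

/-! ### Symplectic rotations and the vectors they single out -/

section Symplectic

variable {ι : Type*} [Fintype ι] [DecidableEq ι]

/-- A real orthogonal skew-symmetric matrix. -/
structure IsSymplecticForm (Ω : Matrix ι ι ℂ) : Prop where
  transpose_eq : Ωᵀ = -Ω
  conjTranspose_eq : Ωᴴ = -Ω
  mul_self : Ω * Ω = -1

/-- `σ` commutes with `S ⊗ S` for all unitary symplectic `S`. -/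
def IsSymplecticInvariant (Ω : Matrix ι ι ℂ) (σ : Matrix (ι × ι) (ι × ι) ℂ) : Prop :=
  ∀ S : Matrix ι ι ℂ, S * Sᴴ = 1 → S * Ω * Sᵀ = Ω → (S ⊗ₖ S) * σ = σ * (S ⊗ₖ S)

/-- The orthogonal projection onto the line spanned by `u`. -/
noncomputable def lineProj (u : ι → ℂ) : Matrix ι ι ℂ :=
  (star u ⬝ᵥ u)⁻¹ • vecMulVec u (star u)

/-- The image of a projection under the quaternionic structure attached to `Ω`. -/
def symplecticPartner (Ω A : Matrix ι ι ℂ) : Matrix ι ι ℂ := -(Ω * Aᵀ * Ω)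

/-- The symplectic rotation with eigenvalue `c` on the range of `A`. -/
def symplecticRotation (Ω A : Matrix ι ι ℂ) (c : ℂ) : Matrix ι ι ℂ :=
  c • A + star c • symplecticPartner Ω A + (1 - A - symplecticPartner Ω A)

omit [DecidableEq ι] in
theorem star_dotProduct_self_ne_zero {u : ι → ℂ} (hu : u ≠ 0) : star u ⬝ᵥ u ≠ 0 :=
  fun h => hu (dotProduct_star_self_eq_zero.1 h)

omit [DecidableEq ι] in
theorem lineProj_mul_self {u : ι → ℂ} (hu : u ≠ 0) : lineProj u * lineProj u = lineProj u := by
  have h := star_dotProduct_self_ne_zero hu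
  rw [lineProj, Matrix.smul_mul, Matrix.mul_smul, Matrix.vecMulVec_mul_vecMulVec,
    Matrix.vecMulVec_smul, smul_smul (_)⁻¹ (star u ⬝ᵥ u), inv_mul_cancel₀ h, one_smul]

omit [DecidableEq ι] in
theorem lineProj_conjTranspose (u : ι → ℂ) : (lineProj u)ᴴ = lineProj u := by
  have h : star (star u ⬝ᵥ u) = star u ⬝ᵥ u := by
    simp [dotProduct, mul_comm]
  rw [lineProj, Matrix.conjTranspose_smul, star_inv₀, h, Matrix.conjTranspose_vecMulVec, star_star]

omit [DecidableEq ι] in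
theorem dotProduct_mulVec_skew {Ω : Matrix ι ι ℂ} (hΩ : Ωᵀ = -Ω) (x y : ι → ℂ) :
    x ⬝ᵥ (Ω *ᵥ y) = -(y ⬝ᵥ (Ω *ᵥ x)) := by
  rw [Matrix.dotProduct_mulVec, ← Matrix.mulVec_transpose, hΩ, Matrix.neg_mulVec, neg_dotProduct,
    dotProduct_comm]

omit [DecidableEq ι] in
theorem dotProduct_mulVec_skew_self {Ω : Matrix ι ι ℂ} (hΩ : Ωᵀ = -Ω) (x : ι → ℂ) :
    x ⬝ᵥ (Ω *ᵥ x) = 0 := by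
  have := dotProduct_mulVec_skew hΩ x x
  linear_combination (1 / 2 : ℂ) * this

-- The product contains the scalar `u* Ω ū`, which vanishes by skewness. Thus `u` is orthogonal to
-- its partner `Ω ū`.
omit [DecidableEq ι] in
theorem lineProj_mul_form_mul_transpose {Ω : Matrix ι ι ℂ} (hΩ : Ωᵀ = -Ω) (u : ι → ℂ) :
    lineProj u * Ω * (lineProj u)ᵀ = 0 := by
  rw [lineProj, Matrix.transpose_smul, Matrix.transpose_vecMulVec, Matrix.smul_mul, Matrix.smul_mul,
    Matrix.mul_smul, Matrix.vecMulVec_mul, Matrix.vecMulVec_mul_vecMulVec,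
    ← Matrix.dotProduct_mulVec, dotProduct_mulVec_skew_self hΩ]
  simp

section Rotation

variable {Ω A : Matrix ι ι ℂ} (hΩ : IsSymplecticForm Ω) (hA : A * A = A) (hAH : Aᴴ = A)
  (hAΩ : A * Ω * Aᵀ = 0)

include hΩ

theorem transpose_mul_form_mul (hAH : Aᴴ = A) (hAΩ : A * Ω * Aᵀ = 0) : Aᵀ * Ω * A = 0 := by
  have h := congrArg (fun M => Mᴴᵀ) hAΩ
  simp only [Matrix.conjTranspose_mul, Matrix.transpose_mul, hΩ.conjTranspose_eq,
    Matrix.transpose_neg, hΩ.transpose_eq, neg_neg, Matrix.conjTranspose_zero,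
    Matrix.transpose_zero, hAH] at h
  have h2 : Aᵀᴴᵀ = A := by
    change Aᵀᵀᴴ = A
    rw [Matrix.transpose_transpose, hAH]
  rwa [h2] at h

theorem symplecticPartner_mul_self (hA : A * A = A) :
    symplecticPartner Ω A * symplecticPartner Ω A = symplecticPartner Ω A := by
  have h : Aᵀ * Aᵀ = Aᵀ := by rw [← Matrix.transpose_mul, hA]
  have : Ω * Aᵀ * Ω * (Ω * Aᵀ * Ω) = Ω * (Aᵀ * (Ω * Ω) * Aᵀ) * Ω := by noncomm_ring
  rw [symplecticPartner, neg_mul_neg, this, hΩ.mul_self, Matrix.mul_neg, Matrix.mul_one,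
    Matrix.neg_mul, h]
  noncomm_ring

theorem symplecticPartner_conjTranspose (hAH : Aᴴ = A) :
    (symplecticPartner Ω A)ᴴ = symplecticPartner Ω A := by
  have h2 : Aᵀᴴ = Aᵀ := by
    change Aᴴᵀ = _
    rw [hAH]
  simp only [symplecticPartner, Matrix.conjTranspose_neg, Matrix.conjTranspose_mul,
    hΩ.conjTranspose_eq, h2]
  noncomm_ring

omit hΩ in
theorem mul_symplecticPartner (hAΩ : A * Ω * Aᵀ = 0) : A * symplecticPartner Ω A = 0 := by
  have : A * symplecticPartner Ω A = -(A * Ω * Aᵀ * Ω) := by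
    rw [symplecticPartner]; noncomm_ring
  rw [this, hAΩ]; simp

theorem symplecticPartner_mul (hAH : Aᴴ = A) (hAΩ : A * Ω * Aᵀ = 0) :
    symplecticPartner Ω A * A = 0 := by
  have : symplecticPartner Ω A * A = -(Ω * (Aᵀ * Ω * A)) := by
    rw [symplecticPartner]; noncomm_ring
  rw [this, transpose_mul_form_mul hΩ hAH hAΩ]; simp

omit hΩ in
theorem mul_symplecticRotation (hA : A * A = A) (hAΩ : A * Ω * Aᵀ = 0) (c : ℂ) :
    A * symplecticRotation Ω A c = c • A := by
  rw [symplecticRotation]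
  simp only [Matrix.mul_add, Matrix.mul_sub, Matrix.mul_smul, hA, mul_symplecticPartner hAΩ,
    Matrix.mul_one]
  simp

theorem symplecticPartner_mul_symplecticRotation (hA : A * A = A) (hAH : Aᴴ = A)
    (hAΩ : A * Ω * Aᵀ = 0) (c : ℂ) :
    symplecticPartner Ω A * symplecticRotation Ω A c = star c • symplecticPartner Ω A := by
  rw [symplecticRotation]
  simp only [Matrix.mul_add, Matrix.mul_sub, Matrix.mul_smul, symplecticPartner_mul_self hΩ hA,
    symplecticPartner_mul hΩ hAH hAΩ, Matrix.mul_one]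
  simp

theorem complement_mul_symplecticRotation (hA : A * A = A) (hAH : Aᴴ = A)
    (hAΩ : A * Ω * Aᵀ = 0) (c : ℂ) :
    (1 - A - symplecticPartner Ω A) * symplecticRotation Ω A c
      = (1 : ℂ) • (1 - A - symplecticPartner Ω A) := by
  rw [Matrix.sub_mul, Matrix.sub_mul, mul_symplecticRotation hA hAΩ,
    symplecticPartner_mul_symplecticRotation hΩ hA hAH hAΩ, Matrix.one_mul, symplecticRotation,
    one_smul]
  abel

theorem symplecticRotation_mul_conjTranspose (hA : A * A = A) (hAH : Aᴴ = A)
    (hAΩ : A * Ω * Aᵀ = 0) {c : ℂ} (hc : c * star c = 1) :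
    symplecticRotation Ω A c * (symplecticRotation Ω A c)ᴴ = 1 := by
  have h : (symplecticRotation Ω A c)ᴴ = symplecticRotation Ω A (star c) := by
    simp [symplecticRotation, Matrix.conjTranspose_add, Matrix.conjTranspose_sub,
      Matrix.conjTranspose_smul, hAH, symplecticPartner_conjTranspose hΩ hAH]
  rw [h]
  nth_rw 1 [symplecticRotation]
  rw [Matrix.add_mul, Matrix.add_mul, Matrix.smul_mul, Matrix.smul_mul,
    mul_symplecticRotation hA hAΩ, symplecticPartner_mul_symplecticRotation hΩ hA hAH hAΩ,
    complement_mul_symplecticRotation hΩ hA hAH hAΩ, smul_smul, smul_smul, star_star, hc,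
    mul_comm (star c), hc]
  simp

/-- Passing a transpose through `Ω` exchanges `A` and its partner, hence `c` and `c̄`. So `Ω Rᵀ = R*
Ω`, and unitarity of `R` concludes. -/
theorem symplecticRotation_mul_form (hA : A * A = A) (hAH : Aᴴ = A)
    (hAΩ : A * Ω * Aᵀ = 0) {c : ℂ} (hc : c * star c = 1) :
    symplecticRotation Ω A c * Ω * (symplecticRotation Ω A c)ᵀ = Ω := by
  have h1 : Ω * Aᵀ = symplecticPartner Ω A * Ω := by
    rw [symplecticPartner, Matrix.neg_mul, Matrix.mul_assoc _ Ω Ω, hΩ.mul_self]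
    simp
  have h2 : Ω * (symplecticPartner Ω A)ᵀ = A * Ω := by
    have : Ω * (symplecticPartner Ω A)ᵀ = -((Ω * Ω) * A * Ω) := by
      simp only [symplecticPartner, Matrix.transpose_neg, Matrix.transpose_mul, hΩ.transpose_eq,
        Matrix.transpose_transpose]
      noncomm_ring
    rw [this, hΩ.mul_self]
    simp
  have h : Ω * (symplecticRotation Ω A c)ᵀ = (symplecticRotation Ω A c)ᴴ * Ω := by
    simp only [symplecticRotation, Matrix.transpose_add, Matrix.transpose_sub,
      Matrix.transpose_smul, Matrix.conjTranspose_add, Matrix.conjTranspose_sub,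
      Matrix.conjTranspose_smul, hAH, symplecticPartner_conjTranspose hΩ hAH, Matrix.mul_add,
      Matrix.add_mul, Matrix.mul_sub, Matrix.sub_mul, Matrix.mul_smul, Matrix.smul_mul, h1, h2,
      star_star, Matrix.transpose_one, Matrix.conjTranspose_one, Matrix.one_mul, Matrix.mul_one]
    abel
  rw [Matrix.mul_assoc, h, ← Matrix.mul_assoc,
    symplecticRotation_mul_conjTranspose hΩ hA hAH hAΩ hc, Matrix.one_mul]

end Rotation

/-- The product vector `u ⊗ v`. -/
def tens (u v : ι → ℂ) : ι × ι → ℂ := fun p => u p.1 * v p.2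

omit [DecidableEq ι] in
theorem kronecker_mulVec_tens (X Y : Matrix ι ι ℂ) (u v : ι → ℂ) :
    (X ⊗ₖ Y) *ᵥ tens u v = tens (X *ᵥ u) (Y *ᵥ v) := by
  ext p
  simp only [Matrix.mulVec, dotProduct, tens, Fintype.sum_prod_type, Matrix.kroneckerMap_apply,
    Finset.sum_mul_sum]
  exact Finset.sum_congr rfl fun i _ => Finset.sum_congr rfl fun j _ => by ring

omit [DecidableEq ι] in
theorem lineProj_kronecker_mulVec (u v : ι → ℂ) (M : ι × ι → ℂ) :
    ∃ α : ℂ, (lineProj u ⊗ₖ lineProj v) *ᵥ M = α • tens u v := by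
  have : vecMulVec u (star u) ⊗ₖ vecMulVec v (star v)
      = vecMulVec (tens u v) (tens (star u) (star v)) := by
    ext p q
    simp only [Matrix.kroneckerMap_apply, vecMulVec_apply, tens, Pi.star_apply]
    ring
  refine ⟨(star u ⬝ᵥ u)⁻¹ * ((star v ⬝ᵥ v)⁻¹ * (tens (star u) (star v) ⬝ᵥ M)), ?_⟩
  rw [lineProj, lineProj, Matrix.smul_kronecker, Matrix.kronecker_smul, this, Matrix.smul_mulVec,
    Matrix.smul_mulVec, Matrix.vecMulVec_mulVec]
  ext p
  simp
  ring

-- The `X ⊗ Y` component of `M` is multiplied by `a b` under `S ⊗ S`, while `M` itself is multiplied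
-- by `w`. Unequal weights annihilate the component.
omit [DecidableEq ι] in
theorem kronecker_mulVec_eq_zero_of_ne {S X Y : Matrix ι ι ℂ} {a b w : ℂ} {M : ι × ι → ℂ}
    (hX : X * S = a • X) (hY : Y * S = b • Y) (hM : (S ⊗ₖ S) *ᵥ M = w • M) (h : a * b - w ≠ 0) :
    (X ⊗ₖ Y) *ᵥ M = 0 := by
  have h1 : (X ⊗ₖ Y) *ᵥ ((S ⊗ₖ S) *ᵥ M) = (a * b) • ((X ⊗ₖ Y) *ᵥ M) := by
    rw [Matrix.mulVec_mulVec, ← Matrix.mul_kronecker_mul, hX, hY, Matrix.smul_kronecker,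
      Matrix.kronecker_smul, Matrix.smul_mulVec, Matrix.smul_mulVec, smul_smul]
  rw [hM, Matrix.mulVec_smul] at h1
  have h2 : (a * b - w) • ((X ⊗ₖ Y) *ᵥ M) = 0 := by rw [sub_smul, ← h1, sub_self]
  exact (smul_eq_zero.1 h2).resolve_left h

theorem eq_sum_kronecker (A B : Matrix ι ι ℂ) (M : ι × ι → ℂ) :
    M = (A ⊗ₖ A) *ᵥ M + (A ⊗ₖ B) *ᵥ M + (A ⊗ₖ (1 - A - B)) *ᵥ M
      + (B ⊗ₖ A) *ᵥ M + (B ⊗ₖ B) *ᵥ M + (B ⊗ₖ (1 - A - B)) *ᵥ M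
      + ((1 - A - B) ⊗ₖ A) *ᵥ M + ((1 - A - B) ⊗ₖ B) *ᵥ M
      + ((1 - A - B) ⊗ₖ (1 - A - B)) *ᵥ M := by
  have h : (1 : Matrix (ι × ι) (ι × ι) ℂ) = (A + B + (1 - A - B)) ⊗ₖ (A + B + (1 - A - B)) := by
    rw [show A + B + (1 - A - B) = 1 by abel, Matrix.one_kronecker_one]
  conv_lhs => rw [← Matrix.one_mulVec M, h]
  simp only [Matrix.add_kronecker, Matrix.kronecker_add, Matrix.add_mulVec]
  abel

/-- A complex number of modulus one and of infinite order. -/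
noncomputable def phase : ℂ := ⟨3 / 5, 4 / 5⟩

theorem phase_mul_star : phase * star phase = 1 := by
  apply Complex.ext <;> norm_num [phase]

section Eigen

variable {Ω A : Matrix ι ι ℂ} (hΩ : IsSymplecticForm Ω) (hA : A * A = A) (hAH : Aᴴ = A)
  (hAΩ : A * Ω * Aᵀ = 0) {M : ι × ι → ℂ}

include hΩ hA hAH hAΩ

theorem eq_kronecker_mulVec_of_weight_two
    (hM : (symplecticRotation Ω A phase ⊗ₖ symplecticRotation Ω A phase) *ᵥ M
      = (phase * phase) • M) : M = (A ⊗ₖ A) *ᵥ M := by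
  have a := mul_symplecticRotation hA hAΩ phase
  have b := symplecticPartner_mul_symplecticRotation hΩ hA hAH hAΩ phase
  have p := complement_mul_symplecticRotation hΩ hA hAH hAΩ phase
  conv_lhs => rw [eq_sum_kronecker A (symplecticPartner Ω A) M]
  rw [kronecker_mulVec_eq_zero_of_ne a b hM, kronecker_mulVec_eq_zero_of_ne a p hM,
    kronecker_mulVec_eq_zero_of_ne b a hM, kronecker_mulVec_eq_zero_of_ne b b hM,
    kronecker_mulVec_eq_zero_of_ne b p hM, kronecker_mulVec_eq_zero_of_ne p a hM,
    kronecker_mulVec_eq_zero_of_ne p b hM, kronecker_mulVec_eq_zero_of_ne p p hM]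
  · simp only [add_zero]
  all_goals
    intro h
    have hre := congrArg Complex.re h
    have him := congrArg Complex.im h
    -- Real parts separate `c²` from every other weight except `c̄²`, which differs only in its
    -- imaginary part.
    first | (norm_num [phase] at hre; done) | norm_num [phase] at him

theorem eq_kronecker_mulVec_of_weight_one
    (hM : (symplecticRotation Ω A phase ⊗ₖ symplecticRotation Ω A phase) *ᵥ M = phase • M) :
    M = (A ⊗ₖ (1 - A - symplecticPartner Ω A) + (1 - A - symplecticPartner Ω A) ⊗ₖ A) *ᵥ M := by
  have a := mul_symplecticRotation hA hAΩ phase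
  have b := symplecticPartner_mul_symplecticRotation hΩ hA hAH hAΩ phase
  have p := complement_mul_symplecticRotation hΩ hA hAH hAΩ phase
  conv_lhs => rw [eq_sum_kronecker A (symplecticPartner Ω A) M]
  rw [kronecker_mulVec_eq_zero_of_ne a a hM, kronecker_mulVec_eq_zero_of_ne a b hM,
    kronecker_mulVec_eq_zero_of_ne b a hM, kronecker_mulVec_eq_zero_of_ne b b hM,
    kronecker_mulVec_eq_zero_of_ne b p hM,
    kronecker_mulVec_eq_zero_of_ne p b hM, kronecker_mulVec_eq_zero_of_ne p p hM]
  · simp only [add_zero, zero_add, Matrix.add_mulVec]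
  all_goals
    intro h
    have := congrArg Complex.im h
    norm_num [phase] at this

end Eigen

omit [DecidableEq ι] in
theorem lineProj_mulVec_self {u : ι → ℂ} (hu : u ≠ 0) : lineProj u *ᵥ u = u := by
  rw [lineProj, Matrix.smul_mulVec, Matrix.vecMulVec_mulVec]
  ext i
  have := star_dotProduct_self_ne_zero hu
  simp
  field_simp

omit [DecidableEq ι] in
theorem lineProj_mulVec_eq_zero {u v : ι → ℂ} (h : star u ⬝ᵥ v = 0) : lineProj u *ᵥ v = 0 := by
  rw [lineProj, Matrix.smul_mulVec, Matrix.vecMulVec_mulVec, h]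
  simp

omit [DecidableEq ι] in
theorem symplecticPartner_lineProj_mulVec {Ω : Matrix ι ι ℂ} {u v : ι → ℂ}
    (h : u ⬝ᵥ (Ω *ᵥ v) = 0) : symplecticPartner Ω (lineProj u) *ᵥ v = 0 := by
  rw [symplecticPartner, lineProj, Matrix.transpose_smul, Matrix.transpose_vecMulVec,
    Matrix.neg_mulVec, ← Matrix.mulVec_mulVec, ← Matrix.mulVec_mulVec, Matrix.smul_mulVec,
    Matrix.vecMulVec_mulVec, h]
  simp

omit [DecidableEq ι] in
theorem lineProj_mul_of_mulVec_eq_zero {X : Matrix ι ι ℂ} {v : ι → ℂ} (h : X *ᵥ v = 0) :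
    X * lineProj v = 0 := by
  rw [lineProj, Matrix.mul_smul, Matrix.mul_vecMulVec, h]
  simp

section Invariant

variable {Ω : Matrix ι ι ℂ} (hΩ : IsSymplecticForm Ω) {σ : Matrix (ι × ι) (ι × ι) ℂ}
  (hσ : IsSymplecticInvariant Ω σ)

include hΩ hσ

theorem IsSymplecticInvariant.rotation_mulVec {u : ι → ℂ} (hu : u ≠ 0) {x : ι × ι → ℂ} {w : ℂ}
    (hx : (symplecticRotation Ω (lineProj u) phase ⊗ₖ symplecticRotation Ω (lineProj u) phase)
      *ᵥ x = w • x) :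
    (symplecticRotation Ω (lineProj u) phase ⊗ₖ symplecticRotation Ω (lineProj u) phase)
      *ᵥ (σ *ᵥ x) = w • (σ *ᵥ x) := by
  have hA := lineProj_mul_self hu
  have hAH := lineProj_conjTranspose u
  have hAΩ := lineProj_mul_form_mul_transpose hΩ.transpose_eq u
  rw [Matrix.mulVec_mulVec,
    hσ _ (symplecticRotation_mul_conjTranspose hΩ hA hAH hAΩ phase_mul_star)
      (symplecticRotation_mul_form hΩ hA hAH hAΩ phase_mul_star),
    ← Matrix.mulVec_mulVec, hx, Matrix.mulVec_smul]

omit hσ in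
theorem symplecticRotation_mulVec_self {u : ι → ℂ} (hu : u ≠ 0) (c : ℂ) :
    symplecticRotation Ω (lineProj u) c *ᵥ u = c • u := by
  have h := symplecticPartner_lineProj_mulVec (dotProduct_mulVec_skew_self hΩ.transpose_eq u)
  simp [symplecticRotation, Matrix.add_mulVec, Matrix.sub_mulVec, Matrix.smul_mulVec, h,
    lineProj_mulVec_self hu]

omit hΩ hσ in
theorem symplecticRotation_mulVec_of_orthogonal {u v : ι → ℂ} (h1 : star u ⬝ᵥ v = 0)
    (h2 : u ⬝ᵥ (Ω *ᵥ v) = 0) (c : ℂ) : symplecticRotation Ω (lineProj u) c *ᵥ v = v := by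
  simp [symplecticRotation, Matrix.add_mulVec, Matrix.sub_mulVec, Matrix.smul_mulVec,
    symplecticPartner_lineProj_mulVec h2, lineProj_mulVec_eq_zero h1]

/-- Squares `u ⊗ u` are eigenvectors. -/
theorem IsSymplecticInvariant.mulVec_tens_self (u : ι → ℂ) :
    ∃ α : ℂ, σ *ᵥ tens u u = α • tens u u := by
  by_cases hu : u = 0
  · refine ⟨0, ?_⟩
    have : tens u u = 0 := by
      ext p
      simp [tens, hu]
    rw [this]
    simp
  have hx : (symplecticRotation Ω (lineProj u) phase ⊗ₖ symplecticRotation Ω (lineProj u) phase)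
      *ᵥ tens u u = (phase * phase) • tens u u := by
    rw [kronecker_mulVec_tens, symplecticRotation_mulVec_self hΩ hu]
    ext p
    simp [tens]
    ring
  have h := eq_kronecker_mulVec_of_weight_two hΩ (lineProj_mul_self hu) (lineProj_conjTranspose u)
    (lineProj_mul_form_mul_transpose hΩ.transpose_eq u) (hσ.rotation_mulVec hΩ hu hx)
  rw [h]
  exact lineProj_kronecker_mulVec u u _

/-- Isotropic orthogonal pairs span invariant planes. -/
theorem IsSymplecticInvariant.mulVec_tens {u v : ι → ℂ} (h1 : star u ⬝ᵥ v = 0)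
    (h2 : u ⬝ᵥ (Ω *ᵥ v) = 0) :
    ∃ α β : ℂ, σ *ᵥ tens u v = α • tens u v + β • tens v u := by
  by_cases hu : u = 0
  · refine ⟨0, 0, ?_⟩
    have : tens u v = 0 := by
      ext p
      simp [tens, hu]
    rw [this]
    simp
  by_cases hv : v = 0
  · refine ⟨0, 0, ?_⟩
    have : tens u v = 0 := by
      ext p
      simp [tens, hv]
    rw [this]
    simp
  have h1' : star v ⬝ᵥ u = 0 := by
    rw [Matrix.star_dotProduct, h1, star_zero]
  have h2' : v ⬝ᵥ (Ω *ᵥ u) = 0 := by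
    rw [dotProduct_mulVec_skew hΩ.transpose_eq, h2, neg_zero]
  have hx : (symplecticRotation Ω (lineProj u) phase ⊗ₖ symplecticRotation Ω (lineProj u) phase)
      *ᵥ tens u v = phase • tens u v := by
    rw [kronecker_mulVec_tens, symplecticRotation_mulVec_self hΩ hu,
      symplecticRotation_mulVec_of_orthogonal h1 h2]
    ext p
    simp [tens]
    ring
  have hy : (symplecticRotation Ω (lineProj v) phase ⊗ₖ symplecticRotation Ω (lineProj v) phase)
      *ᵥ tens u v = phase • tens u v := by
    rw [kronecker_mulVec_tens, symplecticRotation_mulVec_self hΩ hv,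
      symplecticRotation_mulVec_of_orthogonal h1' h2']
    ext p
    simp [tens]
    ring
  have hX := eq_kronecker_mulVec_of_weight_one hΩ (lineProj_mul_self hu) (lineProj_conjTranspose u)
    (lineProj_mul_form_mul_transpose hΩ.transpose_eq u) (hσ.rotation_mulVec hΩ hu hx)
  have hY := eq_kronecker_mulVec_of_weight_one hΩ (lineProj_mul_self hv) (lineProj_conjTranspose v)
    (lineProj_mul_form_mul_transpose hΩ.transpose_eq v) (hσ.rotation_mulVec hΩ hv hy)
  set A := lineProj u
  set C := lineProj v
  set B := symplecticPartner Ω A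
  set D := symplecticPartner Ω C
  have hAC : A * C = 0 := lineProj_mul_of_mulVec_eq_zero (lineProj_mulVec_eq_zero h1)
  have hBC : B * C = 0 :=
    lineProj_mul_of_mulVec_eq_zero (symplecticPartner_lineProj_mulVec h2)
  have hDA : D * A = 0 :=
    lineProj_mul_of_mulVec_eq_zero (symplecticPartner_lineProj_mulVec h2')
  have hAD : A * D = 0 := by
    have := congrArg Matrix.conjTranspose hDA
    rwa [Matrix.conjTranspose_mul, lineProj_conjTranspose,
      symplecticPartner_conjTranspose hΩ (lineProj_conjTranspose v),
      Matrix.conjTranspose_zero] at this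
  have hAQ : A * (1 - C - D) = A := by simp [Matrix.mul_sub, hAC, hAD]
  have hPC : (1 - A - B) * C = C := by simp [Matrix.sub_mul, hAC, hBC]
  -- The rotation about `u` confines the vector to `A ⊗ P + P ⊗ A`, the one about `v` to `C ⊗ Q + Q
  -- ⊗ C`, with `P`, `Q` the complements. As `A C = 0`, `A Q = A` and `P C = C`, the product of
  -- these two operators is `A ⊗ C + C ⊗ A`.
  have hM : σ *ᵥ tens u v = (A ⊗ₖ C + C ⊗ₖ A) *ᵥ (σ *ᵥ tens u v) := by
    conv_lhs => rw [hX, hY]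
    rw [Matrix.mulVec_mulVec, Matrix.add_mul, Matrix.mul_add, Matrix.mul_add,
      ← Matrix.mul_kronecker_mul, ← Matrix.mul_kronecker_mul, ← Matrix.mul_kronecker_mul,
      ← Matrix.mul_kronecker_mul, hAC, hAQ, hPC]
    simp
  rw [hM, Matrix.add_mulVec]
  obtain ⟨α, hα⟩ := lineProj_kronecker_mulVec u v (σ *ᵥ tens u v)
  obtain ⟨β, hβ⟩ := lineProj_kronecker_mulVec v u (σ *ᵥ tens u v)
  exact ⟨α, β, by rw [hα, hβ]⟩

end Invariant

end Symplectic

/-! ### Polarisation and symplectic coordinates -/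

section Coordinates

variable {ι : Type*}

theorem tens_add_left (u u' v : ι → ℂ) : tens (u + u') v = tens u v + tens u' v := by
  ext p; simp [tens, add_mul]

theorem tens_add_right (u v v' : ι → ℂ) : tens u (v + v') = tens u v + tens u v' := by
  ext p; simp [tens, mul_add]

theorem tens_smul_left (c : ℂ) (u v : ι → ℂ) : tens (c • u) v = c • tens u v := by
  ext p; simp [tens, mul_assoc]

theorem tens_smul_right (c : ℂ) (u v : ι → ℂ) : tens u (c • v) = c • tens u v := by
  ext p; simp [tens, mul_left_comm]

variable [DecidableEq ι]

/-- The standard basis vector `e_x`. -/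
abbrev stdVec (x : ι) : ι → ℂ := Pi.single x 1

theorem tens_stdVec (x y : ι) : tens (stdVec x) (stdVec y) = Pi.single (x, y) 1 := by
  ext ⟨a, b⟩
  by_cases h1 : a = x <;> by_cases h2 : b = y <;> simp [tens, h1, h2]

theorem mulVec_tens_stdVec [Fintype ι] (G : Matrix (ι × ι) (ι × ι) ℂ) (x y : ι) (p : ι × ι) :
    (G *ᵥ tens (stdVec x) (stdVec y)) p = G p (x, y) := by
  rw [tens_stdVec, Matrix.mulVec_single_one, Matrix.col_apply]

theorem mulVec_tens_add_self [Fintype ι] (G : Matrix (ι × ι) (ι × ι) ℂ) (x y : ι) (c : ℂ)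
    (p : ι × ι) :
    (G *ᵥ tens (stdVec x + c • stdVec y) (stdVec x + c • stdVec y)) p
      = G p (x, x) + c * (G p (x, y) + G p (y, x)) + c * c * G p (y, y) := by
  simp only [tens_add_left, tens_add_right, tens_smul_left, tens_smul_right, Matrix.mulVec_add,
    Matrix.mulVec_smul, Pi.add_apply, Pi.smul_apply, mulVec_tens_stdVec, smul_eq_mul]
  ring

/-- If all squares `u ⊗ u` are eigenvectors, then the symmetric tensors form an eigenspace. -/
theorem exists_symmetric_eigenvalue [Fintype ι] [Nonempty ι] {σ : Matrix (ι × ι) (ι × ι) ℂ}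
    (h : ∀ u : ι → ℂ, ∃ α : ℂ, σ *ᵥ tens u u = α • tens u u) :
    ∃ l : ℂ, ∀ a b x y, σ (a, b) (x, y) + σ (a, b) (y, x)
      = l * ((1 : Matrix (ι × ι) (ι × ι) ℂ) (a, b) (x, y)
        + (1 : Matrix (ι × ι) (ι × ι) ℂ) (a, b) (y, x)) := by
  choose α hα using fun x => h (stdVec x)
  have hd : ∀ x a b, σ (a, b) (x, x) = α x * (stdVec x a * stdVec x b) := by
    intro x a b
    rw [← mulVec_tens_stdVec σ x x (a, b), hα]
    rfl
  have key : ∀ x y, x ≠ y → α x = α y ∧ ∀ a b, σ (a, b) (x, y) + σ (a, b) (y, x)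
      = α x * (stdVec x a * stdVec y b + stdVec y a * stdVec x b) := by
    intro x y hxy
    -- Comparing entries for the squares of `e_x + e_y` and `e_x - e_y` eliminates `γ` and forces `α
    -- x = β = α y`. The equation for `e_x + e_y` then gives the cross terms.
    obtain ⟨β, hβ⟩ := h (stdVec x + (1 : ℂ) • stdVec y)
    obtain ⟨γ, hγ⟩ := h (stdVec x + (-1 : ℂ) • stdVec y)
    have h1 : ∀ a b, _ := fun a b => (mulVec_tens_add_self σ x y 1 (a, b)).symm.trans
      (congrFun hβ (a, b))
    have h2 : ∀ a b, _ := fun a b => (mulVec_tens_add_self σ x y (-1) (a, b)).symm.trans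
      (congrFun hγ (a, b))
    simp only [hd, tens, Pi.add_apply, Pi.smul_apply, smul_eq_mul] at h1 h2
    have a1 := h1 x x
    have a2 := h2 x x
    have a3 := h1 y y
    have a4 := h2 y y
    have a5 := h1 x y
    have a6 := h2 x y
    simp only [Pi.single_eq_same, Pi.single_eq_of_ne hxy, Pi.single_eq_of_ne hxy.symm]
      at a1 a2 a3 a4 a5 a6
    have e1 : α x = β := by linear_combination (a1 + a2 + a5 + a6) / 2
    have e2 : α y = β := by linear_combination (a3 + a4 + a5 + a6) / 2
    refine ⟨e1.trans e2.symm, fun a b => ?_⟩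
    have := h1 a b
    rw [e2, e1] at this
    rw [e1]
    linear_combination this
  obtain ⟨x₀⟩ := ‹Nonempty ι›
  have hc : ∀ x, α x = α x₀ := fun x => by
    by_cases hx : x = x₀
    · rw [hx]
    · exact (key x x₀ hx).1
  have hone : ∀ a b x y, (1 : Matrix (ι × ι) (ι × ι) ℂ) (a, b) (x, y) = stdVec x a * stdVec y b := by
    intro a b x y
    by_cases h1 : a = x <;> by_cases h2 : b = y <;> simp [Matrix.one_apply, h1, h2]
  refine ⟨α x₀, fun a b x y => ?_⟩
  rw [hone, hone]
  by_cases hxy : x = y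
  · subst hxy
    rw [hd, hc]
    ring
  · rw [(key x y hxy).2, hc]

/-- Coordinates in which the symplectic form is a signed involution without fixed points. -/
structure IsSymplecticBasis (Ω : Matrix ι ι ℂ) (τ : ι → ι) (s : ι → ℂ) : Prop where
  apply_eq : ∀ x y, Ω x y = if y = τ x then s x else 0
  invol : ∀ x, τ (τ x) = x
  ne : ∀ x, τ x ≠ x
  sign_mul : ∀ x, s x * s x = 1
  sign_tau : ∀ x, s (τ x) = -s x
  star_sign : ∀ x, star (s x) = s x
  exists_other : ∀ x, ∃ y, y ≠ x ∧ y ≠ τ x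

namespace IsSymplecticBasis

variable {Ω : Matrix ι ι ℂ} {τ : ι → ι} {s : ι → ℂ} (h : IsSymplecticBasis Ω τ s)

include h

theorem form_tau (x : ι) : Ω x (τ x) = s x := by simp [h.apply_eq]

theorem form_of_ne {x y : ι} (hy : y ≠ τ x) : Ω x y = 0 := by simp [h.apply_eq, hy]

theorem isSymplecticForm [Fintype ι] : IsSymplecticForm Ω := by
  have hT : Ωᵀ = -Ω := by
    ext x y
    rw [Matrix.transpose_apply, Matrix.neg_apply]
    by_cases hy : y = τ x
    · subst hy
      have := h.form_tau (τ x)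
      rw [h.invol] at this
      rw [this, h.form_tau, h.sign_tau]
    · have hx : x ≠ τ y := fun hx => hy (by rw [hx, h.invol])
      rw [h.form_of_ne hy, h.form_of_ne hx, neg_zero]
  have hstar : ∀ x y, star (Ω x y) = Ω x y := by
    intro x y
    rw [h.apply_eq]
    split_ifs
    · exact h.star_sign x
    · exact star_zero _
  refine ⟨hT, ?_, ?_⟩
  · rw [← hT]
    ext x y
    exact hstar y x
  · ext x y
    rw [Matrix.mul_apply, Finset.sum_eq_single (τ x), h.form_tau, h.apply_eq, h.invol, h.sign_tau,
      Matrix.neg_apply, Matrix.one_apply]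
    · by_cases hxy : x = y
      · subst hxy
        simp [h.sign_mul]
      · simp [hxy, Ne.symm hxy]
    · intro z _ hz
      rw [h.form_of_ne hz, zero_mul]
    · simp

/-- The only pairs not compared directly are `x` and `τ x`. An index `z` outside this pair,
available once there are two hyperbolic planes, links them. -/
theorem eq_of_forall_other {X : Type*} {f : ι → X}
    (hf : ∀ x y, y ≠ x → y ≠ τ x → f x = f y) (x y : ι) : f x = f y := by
  by_cases h1 : y = x
  · rw [h1]
  by_cases h2 : y = τ x
  · obtain ⟨z, hz1, hz2⟩ := h.exists_other x
    rw [hf x z hz1 hz2, hf y z (h2 ▸ hz2) (by rw [h2, h.invol]; exact hz1)]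
  · exact hf x y h1 h2

theorem tau_inj {x y : ι} (hxy : τ x = τ y) : x = y := by
  rw [← h.invol x, hxy, h.invol]

theorem other_symm {x y : ι} (h2 : y ≠ τ x) : x ≠ τ y :=
  fun e => h2 (by rw [e, h.invol])

end IsSymplecticBasis

/-! ### Invariant operators on antisymmetric tensors -/

section Wedge

variable {Ω : Matrix ι ι ℂ} {τ : ι → ι} {s : ι → ℂ} (h : IsSymplecticBasis Ω τ s)
  [Fintype ι] {G : Matrix (ι × ι) (ι × ι) ℂ}
  (hr : ∀ a b x y, G (a, b) (y, x) = -G (a, b) (x, y))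
  (hl : ∀ a b x y, G (b, a) (x, y) = -G (a, b) (x, y))
  (hs : ∀ p q, star (G q p) = G p q)
  (hw : ∀ u v : ι → ℂ, star u ⬝ᵥ v = 0 → u ⬝ᵥ (Ω *ᵥ v) = 0 →
    ∃ ν : ℂ, ∀ a b, (G *ᵥ tens u v) (a, b) = ν * (u a * v b - v a * u b))

include h hr hl hw

omit hr hl in
theorem wedge_apply_of_other {x y : ι} (h1 : y ≠ x) (h2 : y ≠ τ x) (a b : ι) :
    G (a, b) (x, y)
      = G (x, y) (x, y) * (stdVec x a * stdVec y b - stdVec y a * stdVec x b) := by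
  obtain ⟨ν, hν⟩ := hw (stdVec x) (stdVec y) (by simp [h1.symm])
    (by simp [h.form_of_ne h2])
  simp only [mulVec_tens_stdVec] at hν
  have := hν x y
  simp only [Pi.single_eq_same, Pi.single_eq_of_ne h1, Pi.single_eq_of_ne h1.symm] at this
  rw [hν, this]
  ring

-- The vector `e_y + e_z` is again orthogonal and isotropic to `e_x`, even when `z = τ y`. A common
-- eigenvalue for it forces those of `e_x ∧ e_y` and `e_x ∧ e_z` to agree.
omit hr hl in
theorem wedge_eigenvalue_eq {x y z : ι} (hy1 : y ≠ x) (hy2 : y ≠ τ x) (hz1 : z ≠ x)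
    (hz2 : z ≠ τ x) : G (x, y) (x, y) = G (x, z) (x, z) := by
  by_cases hyz : y = z
  · rw [hyz]
  obtain ⟨ν, hν⟩ := hw (stdVec x) (stdVec y + stdVec z)
    (by simp [hy1.symm, hz1.symm])
    (by simp [Matrix.mulVec_add, h.form_of_ne hy2, h.form_of_ne hz2])
  simp only [tens_add_right, Matrix.mulVec_add, Pi.add_apply, mulVec_tens_stdVec] at hν
  have e1 := hν x y
  have e2 := hν x z
  rw [wedge_apply_of_other h hw hz1 hz2] at e1
  rw [wedge_apply_of_other h hw hy1 hy2] at e2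
  simp only [Pi.single_eq_same, Pi.single_eq_of_ne hy1, Pi.single_eq_of_ne hy1.symm,
    Pi.single_eq_of_ne hz1, Pi.single_eq_of_ne hz1.symm, Pi.single_eq_of_ne hyz,
    Pi.single_eq_of_ne (Ne.symm hyz)] at e1 e2
  linear_combination e1 - e2

theorem exists_wedge_eigenvalue [Nonempty ι] :
    ∃ μ : ℂ, ∀ x y, y ≠ x → y ≠ τ x → ∀ a b,
      G (a, b) (x, y) = μ * (stdVec x a * stdVec y b - stdVec y a * stdVec x b) := by
  choose o ho1 ho2 using h.exists_other
  have hm : ∀ x y, y ≠ x → y ≠ τ x → G (x, y) (x, y) = G (x, o x) (x, o x) := fun x y h1 h2 =>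
    wedge_eigenvalue_eq h hw h1 h2 (ho1 x) (ho2 x)
  have hc := h.eq_of_forall_other (f := fun x => G (x, o x) (x, o x)) fun x y h1 h2 => by
    rw [← hm x y h1 h2, ← hm y x h1.symm (h.other_symm h2), hr, hl, neg_neg]
  obtain ⟨x₀⟩ := ‹Nonempty ι›
  refine ⟨G (x₀, o x₀) (x₀, o x₀), fun x y h1 h2 a b => ?_⟩
  rw [wedge_apply_of_other h hw h1 h2, hm x y h1 h2, hc x x₀]

include hs

-- The pair `e_x + e_y`, `s_x e_{τx} - s_y e_{τy}` is orthogonal, and isotropic because `s_x² =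
-- s_y²`. Expanding its wedge, the cross terms have eigenvalue `μ`, and what remains compares the
-- two hyperbolic planes.
omit hr hl in
theorem wedge_diagonal_sub_eq {μ : ℂ} (hμ : ∀ x y, y ≠ x → y ≠ τ x → ∀ a b,
      G (a, b) (x, y) = μ * (stdVec x a * stdVec y b - stdVec y a * stdVec x b))
    {x y : ι} (h1 : y ≠ x) (h2 : y ≠ τ x) (a b : ι) :
    s x * G (a, b) (x, τ x) - μ * s x * (stdVec x a * stdVec (τ x) b - stdVec (τ x) a * stdVec x b)
      = s y * G (a, b) (y, τ y)
        - μ * s y * (stdVec y a * stdVec (τ y) b - stdVec (τ y) a * stdVec y b) := by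
  have h2' := h.other_symm h2
  have hx := h.ne x
  have hy := h.ne y
  have htt : τ y ≠ τ x := fun e => h1 (h.tau_inj e)
  obtain ⟨ν, hν⟩ := hw (stdVec x + stdVec y) (s x • stdVec (τ x) + (-s y) • stdVec (τ y))
    (by simp [hx.symm, hy.symm, h2, h2'])
    (by
      have e1 : Ω x (τ y) = 0 := h.form_of_ne htt
      have e2 : Ω y (τ x) = 0 := h.form_of_ne htt.symm
      simp only [Matrix.mulVec_add, Matrix.mulVec_smul, Matrix.mulVec_single_one, add_dotProduct,
        dotProduct_add, dotProduct_smul, single_dotProduct, Matrix.col_apply, h.form_tau, e1, e2,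
        smul_eq_mul]
      linear_combination h.sign_mul x - h.sign_mul y)
  simp only [tens_add_left, tens_add_right, tens_smul_right, Matrix.mulVec_add, Matrix.mulVec_smul,
    Pi.add_apply, Pi.smul_apply, mulVec_tens_stdVec, smul_eq_mul] at hν
  have f1 := hμ x (τ y) h2'.symm htt
  have f2 := hμ y (τ x) h2.symm htt.symm
  have hνμ : ν = μ := by
    -- In the entry `(x, τ y)`, Hermiticity kills the contributions of both hyperbolic planes. Only
    -- a cross term survives, and its eigenvalue is `μ`.
    have e := hν x (τ y)
    have g1 : G (x, τ y) (x, τ x) = 0 := by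
      rw [← hs, f1]
      simp [hx, htt.symm]
    have g2 : G (x, τ y) (y, τ y) = 0 := by
      rw [← hs, f1]
      simp [h1, hy]
    rw [g1, g2, f1, f2] at e
    simp only [Pi.single_eq_same, Pi.single_eq_of_ne h1.symm, Pi.single_eq_of_ne hx.symm,
      Pi.single_eq_of_ne hy, Pi.single_eq_of_ne htt, Pi.single_eq_of_ne h2',
      Pi.single_eq_of_ne h2'.symm] at e
    linear_combination (s y) * e - (ν - μ) * h.sign_mul y
  have e := hν a b
  rw [f1, f2, hνμ] at e
  linear_combination e

/-- A Hermitian operator on antisymmetric tensors, acting by scalars on the planes spanned by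
isotropic orthogonal pairs, is a combination of the identity and of the projection on `Ω`. -/
theorem exists_wedge_decomposition [Nonempty ι] :
    ∃ μ κ : ℂ, ∀ a b x y, G (a, b) (x, y)
      = μ * (stdVec x a * stdVec y b - stdVec y a * stdVec x b) + κ * (Ω a b * Ω x y) := by
  obtain ⟨μ, hμ⟩ := exists_wedge_eigenvalue h hr hl hw
  obtain ⟨x₀⟩ := ‹Nonempty ι›
  -- `N x` measures how far `e_x ∧ e_{τx}` is from being a `μ`-eigenvector. It does not depend on
  -- `x`, and it remains to see that it is a multiple of `Ω`.
  let N : ι → ι → ι → ℂ := fun x a b => s x * G (a, b) (x, τ x)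
    - μ * s x * (stdVec x a * stdVec (τ x) b - stdVec (τ x) a * stdVec x b)
  have hN : ∀ x y, N x = N y := h.eq_of_forall_other fun x y h1 h2 => by
    funext a b
    exact wedge_diagonal_sub_eq h hs hw hμ h1 h2 a b
  have hμs : star μ = μ := by
    obtain ⟨y, h1, h2⟩ := h.exists_other x₀
    have e := hμ x₀ y h1 h2 x₀ y
    simp only [Pi.single_eq_same, Pi.single_eq_of_ne h1] at e
    have e' := hs (x₀, y) (x₀, y)
    rw [e] at e'
    simpa using e'
  have hN0 : ∀ a b, b ≠ τ a → N x₀ a b = 0 := by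
    intro a b hb
    rw [hN x₀ a]
    by_cases hab : b = a
    · subst hab
      have e : G (b, b) (b, τ b) = 0 := by
        have := hl b b b (τ b)
        linear_combination this / 2
      simp [N, e, (h.ne b)]
    · have e : G (a, b) (a, τ a) = 0 := by
        rw [← hs, hμ a b hab hb]
        simp [Ne.symm hab, (h.ne a).symm, Ne.symm hb]
      simp [N, e, hb, hab]
  let K : ι → ℂ := fun a => s a * N x₀ a (τ a)
  -- Hermiticity relates `K a` only to the conjugate of `K x`. Reality, read off from a diagonal
  -- entry of `G`, removes the conjugation.
  have hKs : ∀ a, star (K a) = K a := by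
    intro a
    have : K a = G (a, τ a) (a, τ a) - μ := by
      have e1 : N a a (τ a) = s a * G (a, τ a) (a, τ a) - μ * s a := by
        simp [N, (h.ne a).symm]
      simp only [K]
      rw [hN x₀ a, e1]
      linear_combination (G (a, τ a) (a, τ a) - μ) * h.sign_mul a
    rw [this, star_sub, hs, hμs]
  have hKG : ∀ a x, x ≠ a → x ≠ τ a → K a = s a * s x * G (a, τ a) (x, τ x) := by
    intro a x h1 h2
    simp only [K]
    have h2' := h.other_symm h2
    rw [hN x₀ x]
    have e1 : N x a (τ a) = s x * G (a, τ a) (x, τ x) := by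
      simp [N, h1.symm, h2']
    rw [e1]
    ring
  have hK : ∀ a x, K a = K x := h.eq_of_forall_other fun a x h1 h2 => by
    rw [← hKs x, hKG a x h1 h2, hKG x a h1.symm (h.other_symm h2), star_mul', star_mul',
      h.star_sign, h.star_sign, hs]
    ring
  have hNK : ∀ a b, N x₀ a b = K x₀ * Ω a b := by
    intro a b
    by_cases hb : b = τ a
    · subst hb
      rw [h.form_tau, hK x₀ a]
      simp only [K]
      linear_combination -(N x₀ a (τ a)) * h.sign_mul a
    · rw [hN0 a b hb, h.form_of_ne hb, mul_zero]
  refine ⟨μ, K x₀, fun a b x y => ?_⟩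
  by_cases h1 : y = x
  · subst h1
    have e : G (a, b) (y, y) = 0 := by
      have := hr a b y y
      linear_combination this / 2
    rw [e, h.form_of_ne (h.ne y).symm]
    ring
  by_cases h2 : y = τ x
  · subst h2
    have e := hNK a b
    rw [hN x₀ x] at e
    simp only [N] at e
    rw [h.form_tau]
    linear_combination (s x) * e - (G (a, b) (x, τ x)
      - μ * (stdVec x a * stdVec (τ x) b - stdVec (τ x) a * stdVec x b)) * h.sign_mul x
  · rw [hμ x y h1 h2, h.form_of_ne h2]
    ring

end Wedge

/-- The commutant of `S ⊗ S`, `S` unitary symplectic, is spanned by the identity, the flip and the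
projection on the symplectic form (Hermitian version). -/
theorem IsSymplecticInvariant.exists_decomposition [Fintype ι] [Nonempty ι] {Ω : Matrix ι ι ℂ}
    {τ : ι → ι} {s : ι → ℂ} (h : IsSymplecticBasis Ω τ s) {σ : Matrix (ι × ι) (ι × ι) ℂ}
    (hσ : IsSymplecticInvariant Ω σ) (hH : σ.IsHermitian) :
    ∃ p q r : ℂ, ∀ a b x y, σ (a, b) (x, y)
      = p * (stdVec x a * stdVec y b) + q * (stdVec y a * stdVec x b) + r * (Ω a b * Ω x y) := by
  have hΩ := h.isSymplecticForm
  obtain ⟨l, hsym⟩ := exists_symmetric_eigenvalue (hσ.mulVec_tens_self hΩ)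
  have hls : star l = l := by
    obtain ⟨x⟩ := ‹Nonempty ι›
    have e := hsym x x x x
    simp only [Matrix.one_apply_eq] at e
    have e1 : σ (x, x) (x, x) = l := by linear_combination e / 2
    rw [← e1]
    exact hH.apply _ _
  -- Removing the scalar `l` kills the symmetric tensors. Columns of `G` become antisymmetric, and
  -- Hermiticity transfers this to rows.
  let G : Matrix (ι × ι) (ι × ι) ℂ := σ - l • 1
  have hG : ∀ p q, G p q = σ p q - l * (1 : Matrix (ι × ι) (ι × ι) ℂ) p q := fun p q => rfl
  have hr : ∀ a b x y, G (a, b) (y, x) = -G (a, b) (x, y) := by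
    intro a b x y
    rw [hG, hG]
    linear_combination hsym a b x y
  have hs : ∀ p q, star (G q p) = G p q := by
    have : Gᴴ = G := by
      simp only [G, Matrix.conjTranspose_sub, Matrix.conjTranspose_smul, hH.eq, hls,
        Matrix.conjTranspose_one]
    intro p q
    exact congrFun (congrFun this p) q
  have hl : ∀ a b x y, G (b, a) (x, y) = -G (a, b) (x, y) := by
    intro a b x y
    rw [← hs, hr, star_neg, hs]
  have hw : ∀ u v : ι → ℂ, star u ⬝ᵥ v = 0 → u ⬝ᵥ (Ω *ᵥ v) = 0 →
      ∃ ν : ℂ, ∀ a b, (G *ᵥ tens u v) (a, b) = ν * (u a * v b - v a * u b) := by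
    intro u v h1 h2
    obtain ⟨α, β, hαβ⟩ := hσ.mulVec_tens hΩ h1 h2
    have e : ∀ a b, (G *ᵥ tens u v) (a, b) = (α - l) * (u a * v b) + β * (v a * u b) := by
      intro a b
      simp only [G, Matrix.sub_mulVec, Matrix.smul_mulVec, Matrix.one_mulVec, hαβ, Pi.sub_apply,
        Pi.add_apply, Pi.smul_apply, tens, smul_eq_mul]
      ring
    have e' : ∀ a b, (G *ᵥ tens u v) (b, a) = -(G *ᵥ tens u v) (a, b) := by
      intro a b
      simp only [Matrix.mulVec, dotProduct, ← Finset.sum_neg_distrib]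
      refine Finset.sum_congr rfl fun q _ => ?_
      rw [← Prod.mk.eta (p := q), hl]
      ring
    -- Antisymmetrising `(α - l) u ⊗ v + β v ⊗ u` leaves half the difference of the two
    -- coefficients.
    refine ⟨(α - l - β) / 2, fun a b => ?_⟩
    have := e' a b
    rw [e b a] at this
    linear_combination (e a b) / 2 + this / 2
  obtain ⟨μ, κ, hd⟩ := exists_wedge_decomposition h hr hl hs hw
  refine ⟨l + μ, -μ, κ, fun a b x y => ?_⟩
  have e := hd a b x y
  rw [hG] at e
  have hone : (1 : Matrix (ι × ι) (ι × ι) ℂ) (a, b) (x, y) = stdVec x a * stdVec y b := by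
    by_cases h1 : a = x <;> by_cases h2 : b = y <;> simp [Matrix.one_apply, h1, h2]
  rw [hone] at e
  linear_combination e

end Coordinates

/-! ### Normal form of skew-symmetric unitaries -/

section NormalForm

theorem exists_normalized {ι : Type*} [Fintype ι] {z : ι → ℂ} (hz : z ≠ 0) :
    ∃ c : ℂ, star (c • z) ⬝ᵥ (c • z) = 1 := by
  let y : EuclideanSpace ℂ ι := WithLp.toLp 2 z
  have hy : y ≠ 0 := fun h => hz (by simpa [y] using h)
  have h1 : star z ⬝ᵥ z = ((‖y‖ ^ 2 : ℝ) : ℂ) := by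
    rw [EuclideanSpace.norm_sq_eq]
    simp [dotProduct, y, Complex.conj_mul']
  refine ⟨((‖y‖⁻¹ : ℝ) : ℂ), ?_⟩
  have hne : (‖y‖ : ℂ) ≠ 0 := by exact_mod_cast norm_ne_zero_iff.2 hy
  rw [star_smul, smul_dotProduct, dotProduct_smul, h1]
  simp
  field_simp

theorem exists_isotropic_orthonormal {d : ℕ} {X : Matrix (Fin d) (Fin d) ℂ} (hX : Xᵀ = -X) (m : ℕ)
    (hm : 2 * m ≤ d) : ∃ f : Fin m → Fin d → ℂ,
      (∀ i j, star (f i) ⬝ᵥ f j = if i = j then 1 else 0) ∧ ∀ i j, f i ⬝ᵥ (X *ᵥ f j) = 0 := by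
  induction m with
  | zero => exact ⟨fun i => i.elim0, fun i => i.elim0, fun i => i.elim0⟩
  | succ m ih =>
    obtain ⟨f, hf1, hf2⟩ := ih (by omega)
    let L : (Fin d → ℂ) →ₗ[ℂ] (Fin m → ℂ) × (Fin m → ℂ) :=
      (Matrix.of fun i => star (f i)).mulVecLin.prod ((Matrix.of f) * X).mulVecLin
    -- Orthogonality and isotropy to the vectors already chosen are `2m` linear conditions in
    -- dimension at least `2m + 2`. Isotropy of the new vector with itself is automatic.
    have hL : LinearMap.ker L ≠ ⊥ := LinearMap.ker_ne_bot_of_finrank_lt (by simp; omega)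
    obtain ⟨z₀, hz₀, hne⟩ := Submodule.exists_mem_ne_zero_of_ne_bot hL
    obtain ⟨c, hc⟩ := exists_normalized hne
    have hz : c • z₀ ∈ LinearMap.ker L := Submodule.smul_mem _ _ hz₀
    generalize c • z₀ = z at hc hz
    rw [LinearMap.mem_ker] at hz
    have h1 : ∀ i, star (f i) ⬝ᵥ z = 0 := fun i => congrFun (congrArg Prod.fst hz) i
    have h2 : ∀ i, f i ⬝ᵥ (X *ᵥ z) = 0 := fun i => by
      have := congrFun (congrArg Prod.snd hz) i
      change (((Matrix.of f) * X) *ᵥ z) i = 0 at this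
      rw [← Matrix.mulVec_mulVec] at this
      exact this
    have h1' : ∀ i, star z ⬝ᵥ f i = 0 := fun i => by
      rw [Matrix.star_dotProduct, h1, star_zero]
    have h2' : ∀ i, z ⬝ᵥ (X *ᵥ f i) = 0 := fun i => by
      rw [dotProduct_mulVec_skew hX, h2, neg_zero]
    refine ⟨Fin.snoc f z, fun i j => ?_, fun i j => ?_⟩
    · refine Fin.lastCases ?_ (fun i => ?_) i <;> refine Fin.lastCases ?_ (fun j => ?_) j
      · simp [hc]
      · simp [h1', (Fin.castSucc_lt_last j).ne']
      · simp [h1, (Fin.castSucc_lt_last i).ne]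
      · simp [hf1]
    · refine Fin.lastCases ?_ (fun i => ?_) i <;> refine Fin.lastCases ?_ (fun j => ?_) j
      · simp [dotProduct_mulVec_skew_self hX]
      · simp [h2']
      · simp [h2]
      · simp [hf2]

theorem symplecticOmega_eq_submatrix (n : ℕ) :
    symplecticOmega (n + n) = (fromBlocks 0 1 (-1) 0 :
      Matrix (Fin n ⊕ Fin n) (Fin n ⊕ Fin n) ℂ).submatrix finSumFinEquiv.symm
        finSumFinEquiv.symm := by
  ext x y
  obtain ⟨x, rfl⟩ := finSumFinEquiv.surjective x
  obtain ⟨y, rfl⟩ := finSumFinEquiv.surjective y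
  have hh : (n + n) / 2 = n := by omega
  rw [Matrix.submatrix_apply, Equiv.symm_apply_apply, Equiv.symm_apply_apply]
  rcases x with i | i <;> rcases y with j | j <;>
    simp only [symplecticOmega, Matrix.of_apply, hh, finSumFinEquiv_apply_left,
      finSumFinEquiv_apply_right, Fin.val_castAdd, Fin.val_natAdd, Matrix.fromBlocks_apply₁₁,
      Matrix.fromBlocks_apply₁₂, Matrix.fromBlocks_apply₂₁, Matrix.fromBlocks_apply₂₂,
      Matrix.zero_apply, Matrix.neg_apply, Matrix.one_apply, Fin.ext_iff] <;>
    split_ifs <;> first | rfl | omega | simp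

/-- Skew-symmetric unitary matrices are unitarily congruent to the standard one. -/
theorem exists_unitary_congruence {n : ℕ} {X : Matrix (Fin (n + n)) (Fin (n + n)) ℂ}
    (hX : Xᵀ = -X) (hU : X * Xᴴ = 1) :
    ∃ W : Matrix (Fin (n + n)) (Fin (n + n)) ℂ,
      W * Wᴴ = 1 ∧ W * X * Wᵀ = symplecticOmega (n + n) := by
  obtain ⟨f, hf1, hf2⟩ := exists_isotropic_orthonormal hX n (by omega)
  let F : Matrix (Fin n) (Fin (n + n)) ℂ := Matrix.of f
  have hFF : F * Fᴴ = 1 := by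
    ext i j
    have := hf1 j i
    simp only [dotProduct, Pi.star_apply] at this
    rw [Matrix.mul_apply, Matrix.one_apply]
    simpa [F, mul_comm, eq_comm] using this
  have hFX : F * X * Fᵀ = 0 := by
    ext i j
    have := hf2 i j
    rw [Matrix.mul_assoc, Matrix.mul_apply]
    simpa [dotProduct, Matrix.mulVec, Matrix.mul_apply, F] using this
  -- The entrywise conjugate of `F X` completes the isotropic frame `F` to a unitary: its rows are
  -- orthonormal since `X` is unitary, and `F H* = -F X Fᵀ = 0`.
  let H : Matrix (Fin n) (Fin (n + n)) ℂ := (F * X)ᵀᴴ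
  have hFXFX : (F * X) * (F * X)ᴴ = 1 := by
    rw [Matrix.conjTranspose_mul, Matrix.mul_assoc, ← Matrix.mul_assoc X, hU, Matrix.one_mul, hFF]
  have hFH : F * Hᴴ = 0 := by
    have : F * Hᴴ = -(F * X * Fᵀ) := by
      simp only [H, Matrix.conjTranspose_conjTranspose, Matrix.transpose_mul, hX]
      simp [Matrix.mul_assoc]
    rw [this, hFX, neg_zero]
  have hHF : H * Fᴴ = 0 := by
    rw [← Matrix.conjTranspose_conjTranspose H, ← Matrix.conjTranspose_mul, hFH,
      Matrix.conjTranspose_zero]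
  have hHH : H * Hᴴ = 1 := by
    have := congrArg Matrix.transpose hFXFX
    rw [Matrix.transpose_mul, Matrix.transpose_one] at this
    simp only [H, Matrix.conjTranspose_conjTranspose]
    exact this
  have hFXH : F * X * Hᵀ = 1 := hFXFX
  have hHXF : H * X * Fᵀ = -1 := by
    have := congrArg Matrix.transpose hFXH
    rw [Matrix.transpose_mul, Matrix.transpose_mul, Matrix.transpose_transpose, hX,
      Matrix.transpose_one, Matrix.neg_mul, Matrix.mul_neg, ← Matrix.mul_assoc] at this
    rw [← this, neg_neg]
  have hHXH : H * X * Hᵀ = 0 := by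
    have h1 : X * Hᵀ = Fᴴ := by
      change X * (F * X)ᴴ = Fᴴ
      rw [Matrix.conjTranspose_mul, ← Matrix.mul_assoc, hU, Matrix.one_mul]
    rw [Matrix.mul_assoc, h1, hHF]
  let W : Matrix (Fin n ⊕ Fin n) (Fin (n + n)) ℂ := fromRows F H
  refine ⟨W.submatrix finSumFinEquiv.symm id, ?_, ?_⟩
  · have : W * Wᴴ = 1 := by
      simp only [W, Matrix.conjTranspose_fromRows_eq_fromCols_conjTranspose,
        Matrix.fromRows_mul_fromCols, hFF, hFH, hHF, hHH, Matrix.fromBlocks_one]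
    rw [Matrix.conjTranspose_submatrix, ← Matrix.submatrix_mul _ _ _ id _ Function.bijective_id,
      this, Matrix.submatrix_one_equiv]
  · have : W * X * Wᵀ = fromBlocks 0 1 (-1) 0 := by
      rw [show W * X = fromRows (F * X) (H * X) from Matrix.fromRows_mul _ _ _,
        Matrix.transpose_fromRows, Matrix.fromRows_mul_fromCols, hFX, hFXH, hHXF, hHXH]
    rw [symplecticOmega_eq_submatrix, ← this, Matrix.transpose_submatrix]
    rfl

theorem isSymplecticBasis_symplecticOmega {n : ℕ} (hn : 2 ≤ n) :
    IsSymplecticBasis (symplecticOmega (n + n))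
      (fun x => finSumFinEquiv (finSumFinEquiv.symm x).swap)
      (fun x => Sum.elim (fun _ => 1) (fun _ => -1) (finSumFinEquiv.symm x)) := by
  constructor
  · intro x y
    obtain ⟨x, rfl⟩ := finSumFinEquiv.surjective x
    obtain ⟨y, rfl⟩ := finSumFinEquiv.surjective y
    rw [symplecticOmega_eq_submatrix]
    simp only [Matrix.submatrix_apply, Equiv.symm_apply_apply, EmbeddingLike.apply_eq_iff_eq]
    rcases x with i | i <;> rcases y with j | j <;> simp [Matrix.one_apply, eq_comm]
    split_ifs <;> simp
  · intro x
    simp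
  · intro x
    obtain ⟨x, rfl⟩ := finSumFinEquiv.surjective x
    rcases x with i | i <;>
      simp only [Equiv.symm_apply_apply, ne_eq, EmbeddingLike.apply_eq_iff_eq] <;> simp
  · intro x
    obtain ⟨x, rfl⟩ := finSumFinEquiv.surjective x
    rcases x with i | i <;> simp only [Equiv.symm_apply_apply] <;> simp
  · intro x
    obtain ⟨x, rfl⟩ := finSumFinEquiv.surjective x
    rcases x with i | i <;> simp only [Equiv.symm_apply_apply] <;> simp
  · intro x
    obtain ⟨x, rfl⟩ := finSumFinEquiv.surjective x
    rcases x with i | i <;> simp only [Equiv.symm_apply_apply] <;> simp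
  · intro x
    obtain ⟨x, rfl⟩ := finSumFinEquiv.surjective x
    have : Nontrivial (Fin n) := Fin.nontrivial_iff_two_le.2 hn
    rcases x with i | i <;> obtain ⟨j, hj⟩ := exists_ne i
    · refine ⟨finSumFinEquiv (Sum.inl j), ?_, ?_⟩ <;>
        simp only [Equiv.symm_apply_apply, ne_eq, EmbeddingLike.apply_eq_iff_eq] <;> simp [hj]
    · refine ⟨finSumFinEquiv (Sum.inr j), ?_, ?_⟩ <;>
        simp only [Equiv.symm_apply_apply, ne_eq, EmbeddingLike.apply_eq_iff_eq] <;> simp [hj]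

end NormalForm

/-! ### Symmetrisation by norm minimisation, and identification of the coefficients -/

section Twirl

variable {d : ℕ}

/-- The bipartite vector with the given coefficient matrix, as a function on pairs. -/
def matVec (M : Matrix (Fin d) (Fin d) ℂ) : Fin d × Fin d → ℂ := fun p => M p.1 p.2

theorem kronecker_mulVec_matVec (A B M : Matrix (Fin d) (Fin d) ℂ) :
    (A ⊗ₖ B) *ᵥ matVec M = matVec (A * M * Bᵀ) := by
  ext ⟨a, b⟩
  exact congrFun (congrFun (toMat_kronecker_mulVec A B (matVec M)) a) b

theorem star_matVec_dotProduct (M N : Matrix (Fin d) (Fin d) ℂ) :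
    star (matVec M) ⬝ᵥ matVec N = (Mᴴ * N).trace :=
  star_dotProduct_eq_trace _ _

theorem flipMatrix_mulVec (x : Fin d × Fin d → ℂ) (p : Fin d × Fin d) :
    (flipMatrix d *ᵥ x) p = x p.swap := by
  rw [Matrix.mulVec, dotProduct, Finset.sum_eq_single p.swap]
  · simp [flipMatrix]
  · intro q _ hq
    have : ¬ (p.1 = q.2 ∧ p.2 = q.1) := fun h => hq (Prod.ext h.2.symm h.1.symm)
    simp [flipMatrix, this]
  · simp

theorem flipMatrix_transpose : (flipMatrix d)ᵀ = flipMatrix d := by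
  ext p q
  simp only [Matrix.transpose_apply, flipMatrix, Matrix.of_apply]
  congr 1
  rw [eq_iff_iff]
  constructor <;> rintro ⟨h1, h2⟩ <;> exact ⟨h2.symm, h1.symm⟩

theorem flipMatrix_isHermitian : (flipMatrix d).IsHermitian := by
  rw [Matrix.IsHermitian]
  nth_rw 1 [← flipMatrix_transpose]
  ext p q
  simp [flipMatrix, apply_ite star]

theorem flipMatrix_mul_apply (M : BipartiteMatrix d) (p q : Fin d × Fin d) :
    (flipMatrix d * M) p q = M p.swap q :=
  flipMatrix_mulVec (fun r => M r q) p

theorem mul_flipMatrix_apply (M : BipartiteMatrix d) (p q : Fin d × Fin d) :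
    (M * flipMatrix d) p q = M p q.swap := by
  rw [← Matrix.transpose_apply (M * flipMatrix d), Matrix.transpose_mul, flipMatrix_transpose,
    flipMatrix_mul_apply, Matrix.transpose_apply]

theorem flipMatrix_mul_self : flipMatrix d * flipMatrix d = 1 := by
  ext p q
  rw [flipMatrix_mul_apply]
  simp [flipMatrix, Matrix.one_apply, Prod.ext_iff, and_comm]

theorem flipMatrix_mul_kronecker (S : Matrix (Fin d) (Fin d) ℂ) :
    flipMatrix d * (S ⊗ₖ S) = (S ⊗ₖ S) * flipMatrix d := by
  ext p q
  rw [flipMatrix_mul_apply, mul_flipMatrix_apply]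
  simp [Matrix.kroneckerMap_apply, mul_comm]

theorem trace_flipMatrix : (flipMatrix d).trace = d := by
  simp only [Matrix.trace, Matrix.diag_apply, flipMatrix, Matrix.of_apply, Fintype.sum_prod_type]
  have : ∀ x y : Fin d, (if x = y ∧ y = x then (1 : ℂ) else 0) = if x = y then 1 else 0 := by
    intro x y
    congr 1
    rw [eq_iff_iff]
    exact ⟨fun h => h.1, fun h => ⟨h, h.symm⟩⟩
  simp [this]

/-- The squared Frobenius norm. -/
noncomputable def frobSq (σ : BipartiteMatrix d) : ℝ :=
  ∑ p : (Fin d × Fin d) × (Fin d × Fin d), ‖σ p.1 p.2‖ ^ 2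

theorem frobSq_eq (σ : BipartiteMatrix d) : ((frobSq σ : ℝ) : ℂ) = (σ * σᴴ).trace :=
  (trace_mul_conjTranspose_eq_sum σ).symm

theorem frobSq_conj {U : BipartiteMatrix d} (hU : Uᴴ * U = 1) (σ : BipartiteMatrix d) :
    frobSq (U * σ * Uᴴ) = frobSq σ := by
  have : ((frobSq (U * σ * Uᴴ) : ℝ) : ℂ) = ((frobSq σ : ℝ) : ℂ) := by
    rw [frobSq_eq, frobSq_eq]
    have : U * σ * Uᴴ * (U * σ * Uᴴ)ᴴ = U * (σ * (Uᴴ * U) * σᴴ) * Uᴴ := by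
      simp only [Matrix.conjTranspose_mul, Matrix.conjTranspose_conjTranspose, Matrix.mul_assoc]
    rw [this, hU, Matrix.mul_one, Matrix.trace_mul_comm, ← Matrix.mul_assoc, hU, Matrix.one_mul]
  exact_mod_cast this

/-- The parallelogram law: two minimisers on a convex set must coincide, since otherwise their
midpoint would have smaller norm. -/
theorem frobSq_midpoint (σ τ : BipartiteMatrix d) :
    frobSq ((1 / 2 : ℝ) • σ + (1 / 2 : ℝ) • τ) + frobSq ((1 / 2 : ℝ) • (σ - τ))
      = (frobSq σ + frobSq τ) / 2 := by
  simp only [frobSq]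
  rw [← Finset.sum_add_distrib, ← Finset.sum_add_distrib, Finset.sum_div]
  refine Finset.sum_congr rfl fun p _ => ?_
  simp only [Complex.sq_norm, Complex.normSq_apply, Matrix.add_apply, Matrix.sub_apply,
    Matrix.smul_apply, Complex.add_re, Complex.add_im, Complex.sub_re, Complex.sub_im,
    Complex.smul_re, Complex.smul_im, smul_eq_mul]
  ring

theorem eq_of_frobSq_sub_le_zero {σ τ : BipartiteMatrix d}
    (h : frobSq ((1 / 2 : ℝ) • (σ - τ)) ≤ 0) : σ = τ := by
  have h0 : frobSq ((1 / 2 : ℝ) • (σ - τ)) = 0 :=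
    le_antisymm h (Finset.sum_nonneg fun _ _ => by positivity)
  have h1 := (Finset.sum_eq_zero_iff_of_nonneg (fun _ _ => by positivity)).1 h0
  ext p q
  have := h1 (p, q) (Finset.mem_univ _)
  simpa [sub_eq_zero] using this

theorem continuous_frobSq : Continuous (frobSq (d := d)) := by
  unfold frobSq
  refine continuous_finsetSum _ fun p _ => ?_
  exact ((continuous_id.matrix_elem p.1 p.2).norm).pow 2

/-- Within `SN_k`, every element can be replaced by an invariant one with the same overlaps with
the flip and with the symplectic form. -/
theorem exists_invariant {Ω : Matrix (Fin d) (Fin d) ℂ} {k : ℕ} {ρ : BipartiteMatrix d}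
    (hρ : ρ ∈ schmidtSet d k) :
    ∃ σ ∈ schmidtSet d k, (flipMatrix d * σ).trace = (flipMatrix d * ρ).trace ∧
      star (matVec Ω) ⬝ᵥ (σ *ᵥ matVec Ω) = star (matVec Ω) ⬝ᵥ (ρ *ᵥ matVec Ω) ∧
      IsSymplecticInvariant Ω σ := by
  -- `K` is compact, convex and stable under conjugation by every admissible `S ⊗ S`, which also
  -- preserves the norm. Its unique element of least norm is therefore fixed.
  let K : Set (BipartiteMatrix d) := schmidtSet d k ∩
    {σ | (flipMatrix d * σ).trace = (flipMatrix d * ρ).trace ∧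
      star (matVec Ω) ⬝ᵥ (σ *ᵥ matVec Ω) = star (matVec Ω) ⬝ᵥ (ρ *ᵥ matVec Ω)}
  have hK : IsCompact K := by
    refine (isCompact_schmidtSet d k).inter_right (IsClosed.inter ?_ ?_)
    · exact isClosed_eq (continuous_const.matrix_mul continuous_id).matrix_trace continuous_const
    · exact isClosed_eq (continuous_const.dotProduct (continuous_id.matrix_mulVec continuous_const))
        continuous_const
  obtain ⟨σ, ⟨hσ, hσ1, hσ2⟩, hmin⟩ :=
    hK.exists_isMinOn ⟨ρ, hρ, rfl, rfl⟩ continuous_frobSq.continuousOn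
  refine ⟨σ, hσ, hσ1, hσ2, fun S hS hSΩ => ?_⟩
  have hS' : Sᴴ * S = 1 := mul_eq_one_comm.1 hS
  set U := S ⊗ₖ S with hUdef
  have hU' : Uᴴ * U = 1 := kronecker_unitary hS' hS'
  have hU : U * Uᴴ = 1 := mul_eq_one_comm.1 hU'
  set τ := U * σ * Uᴴ with hτ
  have hτK : τ ∈ schmidtSet d k := schmidtSet_conj hS' hS' hσ
  have hτ1 : (flipMatrix d * τ).trace = (flipMatrix d * ρ).trace := by
    rw [← hσ1, hτ, ← Matrix.mul_assoc, ← Matrix.mul_assoc, flipMatrix_mul_kronecker,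
      Matrix.trace_mul_comm, ← Matrix.mul_assoc, ← Matrix.mul_assoc, hU', Matrix.one_mul]
  have hΩU : U *ᵥ matVec Ω = matVec Ω := by rw [hUdef, kronecker_mulVec_matVec, hSΩ]
  have hΩU' : Uᴴ *ᵥ matVec Ω = matVec Ω := by
    conv_lhs => rw [← hΩU]
    rw [Matrix.mulVec_mulVec, hU', Matrix.one_mulVec]
  have hτ2 : star (matVec Ω) ⬝ᵥ (τ *ᵥ matVec Ω) = star (matVec Ω) ⬝ᵥ (ρ *ᵥ matVec Ω) := by
    rw [← hσ2, hτ, ← Matrix.mulVec_mulVec, ← Matrix.mulVec_mulVec, hΩU', Matrix.dotProduct_mulVec]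
    congr 1
    rw [← Matrix.conjTranspose_conjTranspose U, ← Matrix.star_mulVec, hΩU']
  have hmid : (1 / 2 : ℝ) • σ + (1 / 2 : ℝ) • τ ∈ K := by
    refine ⟨convex_convexHull ℝ _ hσ hτK (by norm_num) (by norm_num) (by norm_num), ?_, ?_⟩
    · rw [Matrix.mul_add, Matrix.mul_smul, Matrix.mul_smul, Matrix.trace_add, Matrix.trace_smul,
        Matrix.trace_smul, hσ1, hτ1, ← add_smul]
      norm_num
    · rw [Matrix.add_mulVec, Matrix.smul_mulVec, Matrix.smul_mulVec, dotProduct_add,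
        dotProduct_smul, dotProduct_smul, hσ2, hτ2, ← add_smul]
      norm_num
  have h1 : frobSq σ ≤ frobSq ((1 / 2 : ℝ) • σ + (1 / 2 : ℝ) • τ) := hmin hmid
  have h2 := frobSq_midpoint σ τ
  rw [show frobSq τ = frobSq σ from frobSq_conj hU' σ] at h2
  have h3 : σ = τ := eq_of_frobSq_sub_le_zero (by linarith)
  change U * σ = σ * U
  conv_rhs => rw [h3, hτ, Matrix.mul_assoc, hU', Matrix.mul_one]

/-- The invariant elements of `SN_k` are combinations of three fixed matrices, with coefficients
determined by the overlaps. -/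
theorem eq_combination_of_invariant {n : ℕ} (hn : 2 ≤ n) {σ : BipartiteMatrix (n + n)}
    (hσ : IsSymplecticInvariant (symplecticOmega (n + n)) σ) (hH : σ.IsHermitian) :
    ∃ p q r : ℂ, σ = p • 1 + q • flipMatrix (n + n)
      + r • vecMulVec (matVec (symplecticOmega (n + n))) (matVec (symplecticOmega (n + n))) := by
  have : Nonempty (Fin (n + n)) := ⟨⟨0, by omega⟩⟩
  obtain ⟨p, q, r, h⟩ := hσ.exists_decomposition (isSymplecticBasis_symplecticOmega hn) hH
  refine ⟨p, q, r, ?_⟩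
  ext ⟨a, b⟩ ⟨x, y⟩
  rw [h]
  have h1 : (1 : BipartiteMatrix (n + n)) (a, b) (x, y) = stdVec x a * stdVec y b := by
    by_cases h1 : a = x <;> by_cases h2 : b = y <;> simp [Matrix.one_apply, h1, h2]
  have h2 : flipMatrix (n + n) (a, b) (x, y) = stdVec y a * stdVec x b := by
    by_cases h1 : a = y <;> by_cases h2 : b = x <;> simp [flipMatrix, h1, h2]
  simp only [Matrix.add_apply, Matrix.smul_apply, smul_eq_mul, h1, h2, vecMulVec_apply, matVec]

theorem matVec_one : matVec (1 : Matrix (Fin d) (Fin d) ℂ)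
    = (Real.sqrt d : ℂ) • (maxEntangled d).ofLp := by
  ext p
  by_cases hd : d = 0
  · subst hd
    exact p.1.elim0
  have : (Real.sqrt d : ℂ) ≠ 0 := by
    exact_mod_cast (Real.sqrt_pos.2 (by exact_mod_cast Nat.pos_of_ne_zero hd)).ne'
  by_cases hp : p.1 = p.2 <;> simp [matVec, maxEntangled, Matrix.one_apply, hp, this]

theorem ofReal_sqrt_mul_self (d : ℕ) : (Real.sqrt d : ℂ) * (Real.sqrt d : ℂ) = d := by
  rw [← Complex.ofReal_mul, Real.mul_self_sqrt (Nat.cast_nonneg d)]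
  simp

theorem vecMulVec_matVec_one :
    vecMulVec (matVec (1 : Matrix (Fin d) (Fin d) ℂ)) (star (matVec 1))
      = (d : ℂ) • pureState (maxEntangled d) := by
  rw [matVec_one, star_smul, Matrix.vecMulVec_smul, Matrix.smul_vecMulVec, smul_smul,
    pureState_eq]
  congr 1
  rw [← ofReal_sqrt_mul_self]
  simp

theorem omegaValue_eq (ρ : BipartiteMatrix d) :
    star (matVec (1 : Matrix (Fin d) (Fin d) ℂ)) ⬝ᵥ (ρ *ᵥ matVec 1) = d * omegaValue ρ := by
  have : omegaValue ρ = star (maxEntangled d).ofLp ⬝ᵥ (ρ *ᵥ (maxEntangled d).ofLp) := by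
    simp only [omegaValue, dotProduct, Matrix.mulVec, Finset.mul_sum, mul_assoc, Pi.star_apply]
  rw [this, matVec_one, star_smul, smul_dotProduct, Matrix.mulVec_smul, dotProduct_smul, smul_smul,
    ← ofReal_sqrt_mul_self]
  simp

theorem star_trace_mul_of_isHermitian {A B : BipartiteMatrix d} (hA : A.IsHermitian)
    (hB : B.IsHermitian) : star (A * B).trace = (A * B).trace := by
  rw [← Matrix.trace_conjTranspose, Matrix.conjTranspose_mul, hA.eq, hB.eq, Matrix.trace_mul_comm]

theorem star_flipValue {V : Matrix (Fin d) (Fin d) ℂ} {ρ : BipartiteMatrix d}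
    (hρ : ρ.IsHermitian) : star (flipValue V ρ) = flipValue V ρ :=
  star_trace_mul_of_isHermitian
    (isHermitian_mul_mul_conjTranspose _ flipMatrix_isHermitian) hρ

theorem star_omegaValue {ρ : BipartiteMatrix d} (hρ : ρ.IsHermitian) :
    star (omegaValue ρ) = omegaValue ρ := by
  simp only [omegaValue, star_sum, star_mul', star_star]
  rw [Finset.sum_comm]
  refine Finset.sum_congr rfl fun p _ => Finset.sum_congr rfl fun q _ => ?_
  rw [hρ.apply]
  ring

theorem ofReal_re_paramA {V : Matrix (Fin d) (Fin d) ℂ} {ρ : BipartiteMatrix d}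
    (hρ : ρ.IsHermitian) : (((paramA V ρ).re : ℝ) : ℂ) = paramA V ρ := by
  refine Complex.conj_eq_iff_re.1 ?_
  have h1 := star_flipValue (V := V) hρ
  have h2 := star_omegaValue hρ
  simp only [← starRingEnd_apply] at h1 h2
  simp [paramA, h1, h2, Complex.conj_ofNat]

theorem ofReal_re_paramB {V : Matrix (Fin d) (Fin d) ℂ} {ρ : BipartiteMatrix d}
    (hρ : ρ.IsHermitian) : (((paramB V ρ).re : ℝ) : ℂ) = paramB V ρ := by
  refine Complex.conj_eq_iff_re.1 ?_
  have h1 := star_flipValue (V := V) hρ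
  have h2 := star_omegaValue hρ
  simp only [← starRingEnd_apply] at h1 h2
  simp [paramB, h1, h2, Complex.conj_ofNat]

theorem flipMatrix_mulVec_matVec {M : Matrix (Fin d) (Fin d) ℂ} (hM : Mᵀ = -M) :
    flipMatrix d *ᵥ matVec M = -matVec M := by
  ext p
  rw [flipMatrix_mulVec]
  exact congrFun (congrFun hM p.1) p.2

/-- The coefficients of an invariant matrix in terms of its trace and overlaps. -/
theorem overlaps_of_combination {n : ℕ} (hn : 2 ≤ n) {σ : BipartiteMatrix (n + n)} {p q r : ℂ}
    (h : σ = p • 1 + q • flipMatrix (n + n)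
      + r • vecMulVec (matVec (symplecticOmega (n + n))) (matVec (symplecticOmega (n + n)))) :
    σ.trace = p * ((n + n : ℕ) : ℂ) ^ 2 + q * (n + n : ℕ) + r * (n + n : ℕ) ∧
    (flipMatrix (n + n) * σ).trace
      = p * (n + n : ℕ) + q * ((n + n : ℕ) : ℂ) ^ 2 - r * (n + n : ℕ) ∧
    star (matVec (symplecticOmega (n + n))) ⬝ᵥ (σ *ᵥ matVec (symplecticOmega (n + n)))
      = p * (n + n : ℕ) - q * (n + n : ℕ) + r * ((n + n : ℕ) : ℂ) ^ 2 := by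
  have hΩ := (isSymplecticBasis_symplecticOmega hn).isSymplecticForm
  generalize symplecticOmega (n + n) = Ω at h hΩ ⊢
  generalize n + n = d at *
  have hstar : star (matVec Ω) = matVec Ω := by
    have : Ωᵀᴴ = Ω := by
      rw [hΩ.transpose_eq, Matrix.conjTranspose_neg, hΩ.conjTranspose_eq, neg_neg]
    ext x
    exact congrFun (congrFun this x.1) x.2
  have hdot : matVec Ω ⬝ᵥ matVec Ω = d := by
    nth_rw 1 [← hstar]
    rw [star_matVec_dotProduct, hΩ.conjTranspose_eq, Matrix.neg_mul, hΩ.mul_self, neg_neg,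
      Matrix.trace_one, Fintype.card_fin]
  have hflip := flipMatrix_mulVec_matVec hΩ.transpose_eq
  have htr1 : (1 : BipartiteMatrix d).trace = (d : ℂ) ^ 2 := by
    rw [Matrix.trace_one, Fintype.card_prod, Fintype.card_fin]
    push_cast
    ring
  refine ⟨?_, ?_, ?_⟩
  · rw [h, Matrix.trace_add, Matrix.trace_add, Matrix.trace_smul, Matrix.trace_smul,
      Matrix.trace_smul, htr1, trace_flipMatrix, Matrix.trace_vecMulVec, hdot]
    simp
  · rw [h, Matrix.mul_add, Matrix.mul_add, Matrix.mul_smul, Matrix.mul_smul, Matrix.mul_smul,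
      Matrix.mul_one, flipMatrix_mul_self, Matrix.mul_vecMulVec, hflip, Matrix.trace_add,
      Matrix.trace_add, Matrix.trace_smul, Matrix.trace_smul,
      Matrix.trace_smul, htr1, trace_flipMatrix, Matrix.trace_vecMulVec, neg_dotProduct, hdot]
    simp only [smul_eq_mul]
    ring
  · rw [h, Matrix.add_mulVec, Matrix.add_mulVec, Matrix.smul_mulVec, Matrix.smul_mulVec,
      Matrix.smul_mulVec, Matrix.one_mulVec, hflip, Matrix.vecMulVec_mulVec, hdot, hstar,
      dotProduct_add, dotProduct_add, dotProduct_smul, dotProduct_smul, dotProduct_smul,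
      dotProduct_neg, dotProduct_smul, hdot]
    simp only [smul_eq_mul, MulOpposite.smul_eq_mul_unop, MulOpposite.unop_op]
    ring

/-- `I ⊗ Ω` sends the vector of `Ω` to the vector of the identity, which is `√d ω`. This is the
source of the factor `d` on `r`. -/
theorem adRight_combination {n : ℕ} (hn : 2 ≤ n) (p q r : ℂ) :
    adRight (symplecticOmega (n + n)) (p • 1 + q • flipMatrix (n + n)
      + r • vecMulVec (matVec (symplecticOmega (n + n))) (matVec (symplecticOmega (n + n))))
    = p • 1 + q • adRight (symplecticOmega (n + n)) (flipMatrix (n + n))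
      + (r * (n + n : ℕ)) • pureState (maxEntangled (n + n)) := by
  have hΩ := (isSymplecticBasis_symplecticOmega hn).isSymplecticForm
  generalize symplecticOmega (n + n) = Ω at hΩ ⊢
  generalize n + n = d at *
  set U : BipartiteMatrix d := (1 : Matrix (Fin d) (Fin d) ℂ) ⊗ₖ Ω with hUdef
  have hΩΩ : Ωᴴ * Ω = 1 := by rw [hΩ.conjTranspose_eq, Matrix.neg_mul, hΩ.mul_self, neg_neg]
  have hU : U * Uᴴ = 1 := mul_eq_one_comm.1 (kronecker_unitary (by simp) hΩΩ)
  have hv : U *ᵥ matVec Ω = matVec 1 := by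
    rw [hUdef, kronecker_mulVec_matVec, Matrix.one_mul, hΩ.transpose_eq, Matrix.mul_neg,
      hΩ.mul_self, neg_neg]
  have hstar : star (matVec Ω) = matVec Ω := by
    have : Ωᵀᴴ = Ω := by
      rw [hΩ.transpose_eq, Matrix.conjTranspose_neg, hΩ.conjTranspose_eq, neg_neg]
    ext x
    exact congrFun (congrFun this x.1) x.2
  have hproj : U * vecMulVec (matVec Ω) (matVec Ω) * Uᴴ
      = (d : ℂ) • pureState (maxEntangled d) := by
    rw [Matrix.mul_vecMulVec, Matrix.vecMulVec_mul, hv]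
    nth_rw 1 [← hstar]
    rw [← Matrix.star_mulVec, hv, vecMulVec_matVec_one]
  change U * _ * Uᴴ = p • 1 + q • (U * flipMatrix d * Uᴴ) + _
  rw [mul_smul, ← hproj]
  simp only [Matrix.mul_add, Matrix.add_mul, Matrix.mul_smul, Matrix.smul_mul, Matrix.mul_one, hU]

/-- A local unitary brings the pair `(F^V, ω)` to the pair formed by the flip and the standard
symplectic form. -/
theorem exists_standard_position {n : ℕ} {V : Matrix (Fin (n + n)) (Fin (n + n)) ℂ}
    (hV : IsSkewUnitary V) {k : ℕ} {ρ : BipartiteMatrix (n + n)} (hρ : ρ ∈ schmidtSet (n + n) k) :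
    ∃ σ ∈ schmidtSet (n + n) k, (flipMatrix (n + n) * σ).trace = flipValue V ρ ∧
      star (matVec (symplecticOmega (n + n))) ⬝ᵥ (σ *ᵥ matVec (symplecticOmega (n + n)))
        = (n + n : ℕ) * omegaValue ρ := by
  obtain ⟨hU, hskew⟩ := hV
  have hVV : V * Vᴴ = 1 := Matrix.mem_unitaryGroup_iff.1 hU
  -- The normal form is applied to `V̄`, because `W ⊗ W V*` sends the vector of the identity to that
  -- of `W V̄ Wᵀ`.
  obtain ⟨W, hW, hWΩ⟩ := exists_unitary_congruence (X := Vᴴᵀ)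
    (by
      rw [Matrix.transpose_transpose, show Vᴴᵀ = Vᵀᴴ from rfl, hskew, Matrix.conjTranspose_neg,
        neg_neg])
    (by
      have := congrArg Matrix.transpose hVV
      rw [Matrix.transpose_mul, Matrix.transpose_one] at this
      rw [show Vᴴᵀᴴ = Vᵀ from by rw [show Vᴴᵀ = Vᵀᴴ from rfl, Matrix.conjTranspose_conjTranspose]]
      exact this)
  generalize symplecticOmega (n + n) = Ω at hWΩ ⊢
  generalize n + n = d at *
  have hW' : Wᴴ * W = 1 := mul_eq_one_comm.1 hW
  have hB : (W * Vᴴ)ᴴ * (W * Vᴴ) = 1 := by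
    rw [Matrix.conjTranspose_mul, Matrix.conjTranspose_conjTranspose, Matrix.mul_assoc,
      ← Matrix.mul_assoc Wᴴ, hW', Matrix.one_mul, hVV]
  set U := W ⊗ₖ (W * Vᴴ) with hUdef
  have hUU : Uᴴ * U = 1 := kronecker_unitary hW' hB
  refine ⟨U * ρ * Uᴴ, schmidtSet_conj hW' hB hρ, ?_, ?_⟩
  · have h1 : U = (W ⊗ₖ W) * ((1 : Matrix (Fin d) (Fin d) ℂ) ⊗ₖ V)ᴴ := by
      rw [Matrix.conjTranspose_kronecker, ← Matrix.mul_kronecker_mul, Matrix.conjTranspose_one,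
        Matrix.mul_one]
    -- The flip commutes with `W ⊗ W`, so only the factor `I ⊗ V*` of `U` acts on it.
    have h2 : Uᴴ * flipMatrix d * U = adRight V (flipMatrix d) := by
      rw [h1, Matrix.conjTranspose_mul, Matrix.conjTranspose_conjTranspose, adRight]
      have : (1 : Matrix (Fin d) (Fin d) ℂ) ⊗ₖ V * (W ⊗ₖ W)ᴴ * flipMatrix d *
          (W ⊗ₖ W * ((1 : Matrix (Fin d) (Fin d) ℂ) ⊗ₖ V)ᴴ)
          = (1 : Matrix (Fin d) (Fin d) ℂ) ⊗ₖ V * ((W ⊗ₖ W)ᴴ * (flipMatrix d *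
          W ⊗ₖ W)) * ((1 : Matrix (Fin d) (Fin d) ℂ) ⊗ₖ V)ᴴ := by
        simp only [Matrix.mul_assoc]
      rw [this, flipMatrix_mul_kronecker, ← Matrix.mul_assoc (W ⊗ₖ W)ᴴ,
        kronecker_unitary hW' hW', Matrix.one_mul]
    rw [flipValue, ← h2, ← Matrix.mul_assoc, ← Matrix.mul_assoc, Matrix.trace_mul_comm,
      ← Matrix.mul_assoc, ← Matrix.mul_assoc]
  · have h1 : U *ᵥ matVec 1 = matVec Ω := by
      rw [hUdef, kronecker_mulVec_matVec, Matrix.mul_one, Matrix.transpose_mul, ← hWΩ,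
        Matrix.mul_assoc]
    have h2 : Uᴴ *ᵥ matVec Ω = matVec 1 := by
      rw [← h1, Matrix.mulVec_mulVec, hUU, Matrix.one_mulVec]
    rw [← omegaValue_eq, ← Matrix.mulVec_mulVec, ← Matrix.mulVec_mulVec, h2,
      Matrix.dotProduct_mulVec]
    congr 1
    rw [← h2, Matrix.star_mulVec, Matrix.conjTranspose_conjTranspose]

theorem mem_symplecticRegion {n : ℕ} (hn : 2 ≤ n) {V : Matrix (Fin (n + n)) (Fin (n + n)) ℂ}
    (hV : IsSkewUnitary V) {k : ℕ} {ρ : BipartiteMatrix (n + n)} (hρ : ρ ∈ schmidtSet (n + n) k) :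
    ((paramA V ρ).re, (paramB V ρ).re) ∈ symplecticRegion (n + n) k := by
  have hHρ := isHermitian_of_mem_schmidtSet hρ
  obtain ⟨σ₀, hσ₀, hf₀, ho₀⟩ := exists_standard_position hV hρ
  obtain ⟨σ, hσ, hf, ho, hinv⟩ := exists_invariant (Ω := symplecticOmega (n + n)) hσ₀
  obtain ⟨p, q, r, h⟩ := eq_combination_of_invariant hn hinv (isHermitian_of_mem_schmidtSet hσ)
  obtain ⟨e1, e2, e3⟩ := overlaps_of_combination hn h
  rw [trace_of_mem_schmidtSet hσ] at e1
  rw [hf, hf₀] at e2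
  rw [ho, ho₀] at e3
  have hΩ := (isSymplecticBasis_symplecticOmega hn).isSymplecticForm
  have hΩΩ : (symplecticOmega (n + n))ᴴ * symplecticOmega (n + n) = 1 := by
    rw [hΩ.conjTranspose_eq, Matrix.neg_mul, hΩ.mul_self, neg_neg]
  have hmem := schmidtSet_conj (A := 1) (B := symplecticOmega (n + n)) (by simp) hΩΩ hσ
  have had := adRight_combination hn p q r
  rw [← h] at had
  have hd4 : 4 ≤ n + n := by omega
  have hd0 : ((n + n : ℕ) : ℂ) ≠ 0 := by exact_mod_cast (by omega : n + n ≠ 0)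
  -- The denominator is `(d - 2)(d + 1)`.
  have hden : ((n + n : ℕ) : ℂ) ^ 2 - (n + n : ℕ) - 2 ≠ 0 := by
    have h1 : ((n + n : ℕ) : ℂ) - 2 ≠ 0 :=
      sub_ne_zero.2 (by exact_mod_cast (by omega : n + n ≠ 2))
    have h2 : ((n + n : ℕ) : ℂ) + 1 ≠ 0 := by exact_mod_cast (by omega : n + n + 1 ≠ 0)
    rw [show ((n + n : ℕ) : ℂ) ^ 2 - (n + n : ℕ) - 2
      = (((n + n : ℕ) : ℂ) - 2) * (((n + n : ℕ) : ℂ) + 1) by ring]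
    exact mul_ne_zero h1 h2
  -- The trace and the two overlaps form a linear system in `p`, `q`, `r`. The formulas for `a` and
  -- `b` are its solution for `r d` and `q d`, and normalisation then determines `p`.
  have ha : paramA V ρ = r * (n + n : ℕ) := by
    rw [paramA, e2, one_div, inv_mul_eq_iff_eq_mul₀ hden]
    linear_combination (((n + n : ℕ) : ℂ) - 1) * e3 - e1
  have hb : paramB V ρ = q * (n + n : ℕ) := by
    rw [paramB, e2, one_div, inv_mul_eq_iff_eq_mul₀ hden]
    linear_combination e3 - e1
  have hp : p = (1 - r * (n + n : ℕ) - q * (n + n : ℕ)) / ((n + n : ℕ) : ℂ) ^ 2 := by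
    rw [eq_div_iff (pow_ne_zero 2 hd0)]
    linear_combination -e1
  change symplecticMatrix (n + n) (paramA V ρ).re (paramB V ρ).re ∈ schmidtSet (n + n) k
  have hgoal : symplecticMatrix (n + n) (paramA V ρ).re (paramB V ρ).re
      = adRight (symplecticOmega (n + n)) σ := by
    rw [had, symplecticMatrix]
    simp only [Complex.ofReal_sub, Complex.ofReal_div, Complex.ofReal_pow, Complex.ofReal_one,
      Complex.ofReal_natCast]
    rw [ofReal_re_paramA hHρ, ofReal_re_paramB hHρ, ha, hb, ← hp, mul_div_assoc, div_self hd0,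
      mul_one]
    abel
  rw [hgoal]
  exact hmem

end Twirl

theorem mainTheorem11 (d : ℕ) (hd : 4 ≤ d) (hd_even : Even d)
    (ρ : BipartiteMatrix d) (hρ : IsQuantumState ρ) :
    (∀ k : ℕ, 1 ≤ k → 2 * k ≤ d → schmidtNumber ρ ≤ k →
      ∀ V : Matrix (Fin d) (Fin d) ℂ, IsSkewUnitary V →
        ρ + (k : ℂ) • adRight V (partialTranspose ρ)
          ≤ (k : ℂ) • (reducedA ρ ⊗ₖ (1 : Matrix (Fin d) (Fin d) ℂ))) ∧
    (∀ V : Matrix (Fin d) (Fin d) ℂ, IsSkewUnitary V →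
      ∃ a b : ℝ, (a : ℂ) = paramA V ρ ∧ (b : ℂ) = paramB V ρ ∧
        ∀ k : ℕ, 1 ≤ k → k ≤ d → schmidtNumber ρ ≤ k →
          (a, b) ∈ symplecticRegion d k) := by
  refine ⟨fun k _ _ hk V hV =>
    add_le_of_mem_schmidtSet hV (mem_schmidtSet_of_schmidtNumber_le hk), fun V hV => ?_⟩
  refine ⟨(paramA V ρ).re, (paramB V ρ).re, ofReal_re_paramA hρ.1.isHermitian,
    ofReal_re_paramB hρ.1.isHermitian, fun k _ _ hk => ?_⟩
  obtain ⟨n, rfl⟩ := hd_even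
  exact mem_symplecticRegion (by omega) hV (mem_schmidtSet_of_schmidtNumber_le hk)
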